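/- Let $k\ge1$ and $d\ge1$ be fixed integers. For each $n$ such that $k$ divides $2dn$ put $m=2dn/k$ and let $\Phi=\Phi_n(d,k)$ be a uniformly random bijection $[m]\times[k]\to\{x_1,\ldots,x_n\}\times[d]\times\{\pm1\}$ (a random $k$-SAT formula with $n$ variables and $m$ clauses in which every variable occurs exactly $d$ times positively and $d$ times negatively). Let $\partial(i,j)$ and $\mathrm{sign}(i,j)$ denote the first and the last component of $\Phi[i,j]$. For $l\ge1$ and a sign pattern $s=(s_2,\ldots,s_{2l+1})\in\{\pm1\}^{2l}$ let $C_s=C_s(\Phi)$ be the number of sequences $(i_2,j_2),\ldots,(i_{2l+1},j_{2l+1})\in[m]\times[k]$ such that 1. $i_2=i_{2l+1}=\min\{i_2,\ldots,i_{2l}\}$, and $i_2,i_4,\ldots,i_{2l}$ are pairwise distinct; 2. $i_{t+1}=i_t$ for every odd $t$ with $3\le t\le 2l-1$; 3. $\partial(i_t,j_t)=\partial(i_{t+1},j_{t+1})$ for every even $t$ with $2\le t\le2l$, and $\partial(i_2,j_2),\partial(i_4,j_4),\ldots,\partial(i_{2l},j_{2l})$ are pairwise distinct; 4. $j_2<j_{2l+1}$;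 5. $\mathrm{sign}(i_t,j_t)=s_t$ for all $2\le t\le 2l+1$. (Thus $C_s$ is the number of cycles of length $2l$ with sign pattern $s$ in the factor graph of $\Phi$.) Moreover, let $$\lambda_s=\frac1{2l}\left(\frac{k-1}2\right)^l(d(d-1))^{l/2}\left(\frac{d-1}{d}\right)^{\frac12\sum_{i=1}^l s_{2i}s_{2i+1}},$$ where for $d=1$ the right-hand side is understood as its limit as $d\downarrow1$ through real values; that is, for $d=1$, $\lambda_s=\frac1{2l}\left(\frac{k-1}2\right)^l$ if $s_{2i}s_{2i+1}=-1$ for all $i\in\{1,\ldots,l\}$, and $\lambda_s=0$ otherwise. Let $S\subset\bigcup_{l\ge1}\{\pm1\}^{2l}$ be a fixed finite set of sign patterns and let $(c_s)_{s\in S}$ be a fixed family of non-negative integers. Then $$\lim_{n\to\infty}\mathbb P\left[\forall s\in S:\ C_s=c_s\right]=\prod_{s\in S}\mathbb P\left[\mathrm{Po}(\lambda_s)=c_s\right],$$ where the limit is taken along the integers $n$ such that $k$ divides $2dn$. That is, the $C_s$, $s\in S$, converge jointly in distribution to independent Poisson variables with means $\lambda_s$. -/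

import Mathlib

open Filter Topology MeasureTheory ProbabilityTheory

noncomputable section

namespace RegularKSAT

/-- A formula with `m` clauses of length `k` over `n` variables, each occurring exactly `d` times
positively and `d` times negatively: a bijection from the literal slots `(i, j)` to the literal
clones `(x, h, ±1)`. The signs `±1` are the units of `ℤ`. -/
abbrev Formula (m k n d : ℕ) : Type := (Fin m × Fin k) ≃ (Fin n × Fin d × ℤˣ)

/-- Every set of formulas is an event. -/
instance (m k n d : ℕ) : MeasurableSpace (Formula m k n d) := ⊤

/-- The variable in a slot. -/
def Formula.var {m k n d : ℕ} (Φ : Formula m k n d) (p : Fin m × Fin k) : Fin n := (Φ p).1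

/-- The sign of the literal in a slot. -/
def Formula.sign {m k n d : ℕ} (Φ : Formula m k n d) (p : Fin m × Fin k) : ℤˣ := (Φ p).2.2

/-- The law of the random formula with `n` variables and `m = 2dn/k` clauses: the uniform
distribution on bijections (used only for `k ∣ 2dn`). -/
def randomFormula (k d n : ℕ) : Measure (Formula (2 * d * n / k) k n d) :=
  uniformOn Set.univ

/-- A sign pattern: an `l ≥ 1` and a vector `(s_2, …, s_{2l+1}) ∈ {±1}^{2l}`.
The entry `s_t` is stored at position `t - 2`, so parities of indices are unchanged. -/
abbrev SignPattern : Type := Σ l : ℕ+, (Fin (2 * (l : ℕ)) → ℤˣ)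

/-- The first position (index `t = 2`). -/
def firstPos (l : ℕ+) : Fin (2 * (l : ℕ)) := ⟨0, by have := l.pos; omega⟩

/-- The last position (index `t = 2l + 1`). -/
def lastPos (l : ℕ+) : Fin (2 * (l : ℕ)) := ⟨2 * (l : ℕ) - 1, by have := l.pos; omega⟩

/-- The slots `(i_2, j_2), …, (i_{2l+1}, j_{2l+1})` (again stored with shift `2`) form a cycle
with sign pattern `s` in the factor graph of `Φ`. -/
structure IsCycle {m k n d : ℕ} (Φ : Formula m k n d) (s : SignPattern)
    (p : Fin (2 * (s.1 : ℕ)) → Fin m × Fin k) : Prop where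
  /-- The walk closes up at the clause that it starts from. -/
  closed : (p (firstPos s.1)).1 = (p (lastPos s.1)).1
  /-- The initial clause has the smallest index. -/
  start_min : ∀ t, (p (firstPos s.1)).1 ≤ (p t).1
  /-- The clauses `i_2, i_4, …, i_{2l}` are pairwise distinct. -/
  clauses_distinct : ∀ t t' : Fin (2 * (s.1 : ℕ)),
    Even (t : ℕ) → Even (t' : ℕ) → (p t).1 = (p t').1 → t = t'
  /-- `i_{t+1} = i_t` for odd `t`. -/
  clause_step : ∀ t t' : Fin (2 * (s.1 : ℕ)),
    Odd (t : ℕ) → (t' : ℕ) = t + 1 → (p t').1 = (p t).1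
  /-- The slots `t` and `t + 1` contain the same variable for even `t`. -/
  var_step : ∀ t t' : Fin (2 * (s.1 : ℕ)),
    Even (t : ℕ) → (t' : ℕ) = t + 1 → Φ.var (p t) = Φ.var (p t')
  /-- The variables at `t = 2, 4, …, 2l` are pairwise distinct. -/
  vars_distinct : ∀ t t' : Fin (2 * (s.1 : ℕ)),
    Even (t : ℕ) → Even (t' : ℕ) → Φ.var (p t) = Φ.var (p t') → t = t'
  /-- Orientation: `j_2 < j_{2l+1}`. -/
  oriented : (p (firstPos s.1)).2 < (p (lastPos s.1)).2
  /-- The signs are as prescribed. -/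
  signs : ∀ t, Φ.sign (p t) = s.2 t

/-- `C_s(Φ)`, the number of cycles with sign pattern `s`. -/
def cycleCount {m k n d : ℕ} (s : SignPattern) (Φ : Formula m k n d) : ℕ :=
  Nat.card {p : Fin (2 * (s.1 : ℕ)) → Fin m × Fin k // IsCycle Φ s p}

/-- `∑_{i=1}^l s_{2i} s_{2i+1}`. -/
def SignPattern.corr (s : SignPattern) : ℤ :=
  ∑ i : Fin (s.1 : ℕ),
    (s.2 ⟨2 * (i : ℕ), by omega⟩ : ℤ) * (s.2 ⟨2 * (i : ℕ) + 1, by omega⟩ : ℤ)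

/-- `λ_s = (1/2l) ((k-1)/2)^l (d(d-1))^{l/2} ((d-1)/d)^{(1/2) ∑ s_{2i} s_{2i+1}}`.
The product of the last two factors is `(d-1)^a d^{l-a}`, where `a` is the number of `i` with
`s_{2i} = s_{2i+1}`. For `d = 1`, where the displayed expression may be of the form `0 · ∞`,
this product is `0^a`, that is, `1` if `∑ s_{2i} s_{2i+1} = -l` and `0` otherwise. -/
def cycleMean (k d : ℕ) (s : SignPattern) : ℝ :=
  1 / (2 * ((s.1 : ℕ) : ℝ)) * (((k : ℝ) - 1) / 2) ^ (s.1 : ℕ) *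
    (if d = 1 then (if s.corr = -((s.1 : ℕ) : ℤ) then 1 else 0)
      else ((d : ℝ) * ((d : ℝ) - 1)) ^ (((s.1 : ℕ) : ℝ) / 2) *
        (((d : ℝ) - 1) / (d : ℝ)) ^ ((1 / 2 : ℝ) * (s.corr : ℝ)))

theorem cycleMean_nonneg {k d : ℕ} (hk : 1 ≤ k) (hd : 1 ≤ d) (s : SignPattern) :
    0 ≤ cycleMean k d s := by
  have h1 : (0 : ℝ) ≤ (k : ℝ) - 1 := sub_nonneg.2 (by exact_mod_cast hk)
  have h2 : (0 : ℝ) ≤ (d : ℝ) - 1 := sub_nonneg.2 (by exact_mod_cast hd)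
  unfold cycleMean
  split_ifs <;> positivity

end RegularKSAT

end

/-! The proof uses the method of moments. The product of the falling factorials of order `r s` of
the `C_s` counts ordered families of distinct cycles, `r s` of them with pattern `s`. It suffices
that the expected number of such families tends to the product of the `λ_s ^ r s`
(`tendsto_mean_familyCount`); Bonferroni's inequalities turn this into convergence of the joint
probabilities (`tendsto_mean_indicator_of_factorial_moments`).

Let `L` be the sum of the half-lengths `l` of the cycles in a family. Being a cycle splits into a
condition on the slots `p` and one on the clones `Φ ∘ p` (`isCycle_iff`). Hence the expected number
of vertex-disjoint families is the number of clause-disjoint slot families, times the number of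
variable-disjoint clone families, times `(mk - 2L)! / (mk)!`. Asymptotically, a cycle contributes
`m^l (k(k-1))^l / (2l)` from its slots, `n^l` times `d(d-1)` or `d²` per variable (equal or opposite
signs) from its clones, and `(2dn)^(-2l)` from the bijection. With `m = 2dn/k` this is `λ_s`.

Families of distinct but overlapping cycles are negligible. If their union has `a` clauses, `v`
variables and `e` slots, then `a + v < e` (`IsCycleFamily.disjoint_or_lt`): each clause and each
variable meets at least two slots, and if `a + v ≥ e` then each meets exactly two, in which case
cycles that share a slot coincide. The expected number of such unions is `O(n^(a+v-e))`, and only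
finitely many triples occur. -/

noncomputable section

namespace RegularKSAT

/-! ### Factorial moments and Poisson convergence. -/

/-- The mean of a real function on a finite type. -/
def mean {Ω : Type*} [Fintype Ω] (f : Ω → ℝ) : ℝ := (∑ ω, f ω) / Fintype.card Ω

theorem mean_sub {Ω : Type*} [Fintype Ω] (f g : Ω → ℝ) :
    mean (fun ω => f ω - g ω) = mean f - mean g := by
  simp [mean, Finset.sum_sub_distrib, sub_div]

theorem mean_sum {Ω ι : Type*} [Fintype Ω] (s : Finset ι) (f : ι → Ω → ℝ) :
    mean (fun ω => ∑ i ∈ s, f i ω) = ∑ i ∈ s, mean (f i) := by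
  simp only [mean]
  rw [Finset.sum_comm, Finset.sum_div]

theorem mean_const_mul {Ω : Type*} [Fintype Ω] (a : ℝ) (f : Ω → ℝ) :
    mean (fun ω => a * f ω) = a * mean f := by
  simp only [mean, ← Finset.mul_sum, mul_div_assoc]

theorem mean_mono {Ω : Type*} [Fintype Ω] {f g : Ω → ℝ} (h : ∀ ω, f ω ≤ g ω) :
    mean f ≤ mean g := by
  unfold mean
  gcongr
  exact h _

theorem abs_mean_le {Ω : Type*} [Fintype Ω] (f : Ω → ℝ) : |mean f| ≤ mean (fun ω => |f ω|) := by
  unfold mean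
  rw [abs_div, Nat.abs_cast]
  gcongr
  exact Finset.abs_sum_le_sum_abs _ _

/-- Pascal's rule makes the sum telescope. The closed form is the exact error of truncated
inclusion-exclusion. -/
theorem alternating_sum_range_succ_choose (M J : ℕ) :
    ∑ j ∈ Finset.range (J + 1), (-1 : ℝ) ^ j * ((M + 1).choose j : ℝ)
      = (-1) ^ J * (M.choose J : ℝ) := by
  induction J with
  | zero => simp
  | succ J ih =>
    rw [Finset.sum_range_succ, ih, Nat.choose_succ_succ]
    push_cast
    ring

/-- Bonferroni's inequality for the event that a non-negative integer vanishes. -/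
theorem abs_indicator_zero_sub_alternating_sum_le (M J : ℕ) :
    |(if M = 0 then (1 : ℝ) else 0) - ∑ j ∈ Finset.range J, (-1 : ℝ) ^ j * (M.choose j : ℝ)|
      ≤ M.choose J := by
  rcases J with _ | J
  · simp only [Finset.range_zero, Finset.sum_empty, sub_zero, Nat.choose_zero_right, Nat.cast_one]
    split_ifs <;> simp
  rcases M with _ | M
  · rw [Finset.sum_range_succ']
    simp
  · rw [alternating_sum_range_succ_choose]
    simp only [Nat.add_eq_zero_iff, one_ne_zero, and_false, if_false, zero_sub, abs_neg, abs_mul,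
      abs_pow, abs_one, one_pow, one_mul, Nat.abs_cast]
    rw [Nat.choose_succ_succ]
    push_cast
    linarith [Nat.cast_nonneg (α := ℝ) (M.choose (J + 1))]

/-- Bonferroni's inequality for the event that a non-negative integer takes the value `c`. -/
theorem abs_indicator_sub_alternating_sum_le (X c J : ℕ) :
    |(if X = c then (1 : ℝ) else 0) - ∑ j ∈ Finset.range J,
        (-1 : ℝ) ^ j * ((c + j).choose c : ℝ) * (X.choose (c + j) : ℝ)|
      ≤ ((c + J).choose c : ℝ) * X.choose (c + J) := by
  -- Choosing `c + j` objects and then `c` among them amounts to choosing `c` and then `j` of the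
  -- rest; this reduces the claim to the vanishing of `X - c`.
  have key : ∀ j, ((c + j).choose c : ℝ) * (X.choose (c + j) : ℝ)
      = X.choose c * (X - c).choose j := fun j => by
    have := Nat.choose_mul (n := X) (k := c + j) (s := c) (by omega)
    rw [Nat.add_sub_cancel_left] at this
    rw [mul_comm]
    exact_mod_cast this
  simp_rw [mul_assoc, key]
  -- For `X < c` the truncated difference `X - c` vanishes although `X ≠ c`, but then all the
  -- binomials are zero.
  rcases lt_or_ge X c with h | h
  · simp [Nat.choose_eq_zero_of_lt h, h.ne]
  · have h1 : (if X = c then (1 : ℝ) else 0) = X.choose c * (if X - c = 0 then (1 : ℝ) else 0) := by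
      by_cases hx : X = c
      · simp [hx]
      · have : X - c ≠ 0 := by omega
        simp [hx, this]
    have h2 : ∑ j ∈ Finset.range J, (-1 : ℝ) ^ j * ((X.choose c : ℝ) * ((X - c).choose j : ℝ))
        = X.choose c * ∑ j ∈ Finset.range J, (-1 : ℝ) ^ j * ((X - c).choose j : ℝ) := by
      rw [Finset.mul_sum]
      exact Finset.sum_congr rfl fun j _ => by ring
    rw [h1, h2, ← mul_sub, abs_mul, Nat.abs_cast]
    gcongr
    exact abs_indicator_zero_sub_alternating_sum_le _ _

/-- Factors are replaced one at a time, with `|b i| ≤ 1 + e i`. The bound is itself a product minus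
one, so its mean is controlled by the same factorial moments as the main term. -/
theorem abs_prod_sub_prod_le {ι : Type*} (s : Finset ι) (a b e : ι → ℝ)
    (ha : ∀ i, |a i| ≤ 1) (he : ∀ i, |a i - b i| ≤ e i) :
    |∏ i ∈ s, a i - ∏ i ∈ s, b i| ≤ ∏ i ∈ s, (1 + e i) - 1 := by
  classical
  induction s using Finset.induction_on with
  | empty => simp
  | insert i s hi ih =>
    rw [Finset.prod_insert hi, Finset.prod_insert hi, Finset.prod_insert hi]
    have he0 : 0 ≤ e i := (abs_nonneg _).trans (he i)
    have hb : |∏ j ∈ s, b j| ≤ ∏ j ∈ s, (1 + e j) := by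
      rw [Finset.abs_prod]
      refine Finset.prod_le_prod (fun _ _ => abs_nonneg _) fun j _ => ?_
      have h1 := ha j
      have h2 := he j
      rw [abs_le] at *
      constructor <;> linarith
    have h3 : a i * ∏ j ∈ s, a j - b i * ∏ j ∈ s, b j
        = a i * (∏ j ∈ s, a j - ∏ j ∈ s, b j) + (a i - b i) * ∏ j ∈ s, b j := by ring
    rw [h3]
    refine (abs_add_le _ _).trans ?_
    rw [abs_mul, abs_mul]
    have h4 : |a i| * |∏ j ∈ s, a j - ∏ j ∈ s, b j| ≤ 1 * (∏ j ∈ s, (1 + e j) - 1) :=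
      mul_le_mul (ha i) ih (abs_nonneg _) zero_le_one
    have h5 : |a i - b i| * |∏ j ∈ s, b j| ≤ e i * ∏ j ∈ s, (1 + e j) :=
      mul_le_mul (he i) hb (abs_nonneg _) he0
    linarith

/-- The truncation level `J` is fixed before the limit along `F` is taken, so no uniformity in `J`
is needed. -/
theorem tendsto_of_approx {α : Type*} {F : Filter α} {P : α → ℝ} {A D : ℕ → α → ℝ}
    {B E : ℕ → ℝ} {x : ℝ} (h : ∀ J n, |P n - A J n| ≤ D J n)
    (hA : ∀ J, Tendsto (A J) F (𝓝 (B J))) (hD : ∀ J, Tendsto (D J) F (𝓝 (E J)))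
    (hB : Tendsto B atTop (𝓝 x)) (hE : Tendsto E atTop (𝓝 0)) : Tendsto P F (𝓝 x) := by
  rw [Metric.tendsto_nhds]
  intro ε hε
  have h5 : 0 < ε / 5 := by positivity
  obtain ⟨J, hJ1, hJ2⟩ := ((Metric.tendsto_nhds.1 hB _ h5).and
    (Metric.tendsto_nhds.1 hE _ h5)).exists
  filter_upwards [Metric.tendsto_nhds.1 (hA J) _ h5, Metric.tendsto_nhds.1 (hD J) _ h5]
    with n h1 h2
  have h3 := h J n
  rw [Real.dist_eq, abs_lt] at *
  rw [abs_le] at h3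
  constructor <;> linarith [h1.1, h1.2, h2.1, h2.2, h3.1, h3.2, hJ1.1, hJ1.2, hJ2.1, hJ2.2]

/-- Convergence of the joint factorial moments, extended to products of linear combinations. -/
theorem tendsto_mean_prod_sum_descFactorial {α S : Type*} [Fintype S] {F : Filter α}
    {Ω : α → Type*} [∀ n, Fintype (Ω n)] (X : ∀ n, Ω n → S → ℕ) (lam : S → ℝ)
    (h : ∀ r : S → ℕ, Tendsto (fun n => mean fun ω : Ω n =>
      ∏ s, ((X n ω s).descFactorial (r s) : ℝ)) F (𝓝 (∏ s, lam s ^ r s)))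
    (R : Finset ℕ) (u : S → ℕ → ℝ) (r : S → ℕ → ℕ) :
    Tendsto (fun n => mean fun ω : Ω n =>
      ∏ s, ∑ j ∈ R, u s j * ((X n ω s).descFactorial (r s j) : ℝ)) F
      (𝓝 (∏ s, ∑ j ∈ R, u s j * lam s ^ r s j)) := by
  classical
  simp_rw [Finset.prod_univ_sum, Finset.prod_mul_distrib]
  have h1 : ∀ n, (mean fun ω : Ω n => ∑ x ∈ Fintype.piFinset fun _ : S => R,
      (∏ s, u s (x s)) * ∏ s, ((X n ω s).descFactorial (r s (x s)) : ℝ))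
      = ∑ x ∈ Fintype.piFinset fun _ : S => R, (∏ s, u s (x s)) *
        mean fun ω : Ω n => ∏ s, ((X n ω s).descFactorial (r s (x s)) : ℝ) := fun n => by
    rw [mean_sum]
    exact Finset.sum_congr rfl fun x _ => mean_const_mul _ _
  simp_rw [h1]
  exact tendsto_finsetSum _ fun x _ => (h fun s => r s (x s)).const_mul _

theorem cast_choose_eq_inv_factorial_mul_descFactorial (n r : ℕ) :
    (n.choose r : ℝ) = (r.factorial : ℝ)⁻¹ * n.descFactorial r := by
  rw [Nat.descFactorial_eq_factorial_mul_choose]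
  push_cast
  rw [inv_mul_cancel_left₀ (by exact_mod_cast r.factorial_ne_zero)]

/-- The method of factorial moments for joint convergence to independent Poisson variables. -/
theorem tendsto_mean_indicator_of_factorial_moments {α S : Type*} [Fintype S] {F : Filter α}
    {Ω : α → Type*} [∀ n, Fintype (Ω n)] (X : ∀ n, Ω n → S → ℕ) (lam : S → ℝ)
    (h : ∀ r : S → ℕ, Tendsto (fun n => mean fun ω : Ω n =>
      ∏ s, ((X n ω s).descFactorial (r s) : ℝ)) F (𝓝 (∏ s, lam s ^ r s))) (c : S → ℕ) :
    Tendsto (fun n => mean fun ω : Ω n => ∏ s, if X n ω s = c s then (1 : ℝ) else 0) F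
      (𝓝 (∏ s, Real.exp (-lam s) * lam s ^ c s / (c s).factorial)) := by
  let u : S → ℕ → ℝ := fun s j =>
    (-1 : ℝ) ^ j * ((c s + j).choose (c s) : ℝ) * ((c s + j).factorial : ℝ)⁻¹
  -- `v` and `r` write the factor `1 + e` of the error bound as a two-term combination of falling
  -- factorials, the first of order zero.
  let v : ℕ → S → ℕ → ℝ := fun J s j =>
    if j = 0 then 1 else ((c s + J).choose (c s) : ℝ) * ((c s + J).factorial : ℝ)⁻¹
  let r : ℕ → S → ℕ → ℕ := fun J s j => if j = 0 then 0 else c s + J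
  have hfac : ∀ s j, ((c s + j).choose (c s) : ℝ) * ((c s + j).factorial : ℝ)⁻¹
      = ((c s).factorial : ℝ)⁻¹ * (j.factorial : ℝ)⁻¹ := fun s j => by
    rw [Nat.cast_choose ℝ (Nat.le_add_right _ _), Nat.add_sub_cancel_left]
    have := (c s + j).factorial_ne_zero
    field_simp
  -- Some `Ω n` may be empty, with mean `0` by the convention `0 / 0 = 0`; the moment of order zero
  -- excludes this in the limit.
  have h0 : Tendsto (fun n => mean fun _ : Ω n => (1 : ℝ)) F (𝓝 1) := by
    simpa using h fun _ => 0
  refine tendsto_of_approx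
    (A := fun J n => mean fun ω : Ω n =>
      ∏ s, ∑ j ∈ Finset.range J, u s j * ((X n ω s).descFactorial (c s + j) : ℝ))
    (D := fun J n => (mean fun ω : Ω n =>
      ∏ s, ∑ j ∈ Finset.range 2, v J s j * ((X n ω s).descFactorial (r J s j) : ℝ))
        - mean fun _ : Ω n => (1 : ℝ)) ?_
    (fun J => tendsto_mean_prod_sum_descFactorial X lam h (Finset.range J) u fun s j => c s + j)
    (fun J => (tendsto_mean_prod_sum_descFactorial X lam h (Finset.range 2) (v J) (r J)).sub h0)
    ?_ ?_
  · intro J n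
    rw [← mean_sub, ← mean_sub]
    refine (abs_mean_le _).trans (mean_mono fun ω => ?_)
    have hv : ∀ s, ∑ j ∈ Finset.range 2, v J s j * ((X n ω s).descFactorial (r J s j) : ℝ)
        = 1 + ((c s + J).choose (c s) : ℝ) * (X n ω s).choose (c s + J) := fun s => by
      simp [Finset.sum_range_succ, v, r, cast_choose_eq_inv_factorial_mul_descFactorial _ (c s + J),
        mul_assoc]
    simp_rw [hv]
    refine abs_prod_sub_prod_le _ _ _ _ (fun s => ?_) fun s => ?_
    · split_ifs <;> simp
    · convert abs_indicator_sub_alternating_sum_le (X n ω s) (c s) J using 4 with j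
      simp only [u]
      rw [cast_choose_eq_inv_factorial_mul_descFactorial _ (c s + _)]
      ring
  -- As `J` grows, the truncated sums become the exponential series of `-lam s`.
  · refine tendsto_finsetProd _ fun s _ => ?_
    have h1 : HasSum (fun j : ℕ => u s j * lam s ^ (c s + j))
        (Real.exp (-lam s) * lam s ^ c s / (c s).factorial) := by
      have h2 := (NormedSpace.expSeries_div_hasSum_exp (-lam s)).mul_left
        (lam s ^ c s / (c s).factorial)
      rw [← Real.exp_eq_exp_ℝ] at h2
      have h3 : ∀ j : ℕ, u s j * lam s ^ (c s + j)
          = lam s ^ c s / (c s).factorial * ((-lam s) ^ j / j.factorial) := fun j => by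
        simp only [u]
        rw [mul_assoc ((-1 : ℝ) ^ j), hfac, neg_pow (lam s), pow_add]
        field_simp
      simp_rw [h3]
      rwa [mul_div_assoc, mul_comm]
    exact h1.tendsto_sum_nat
  · have h1 : ∀ s, Tendsto (fun J => ∑ j ∈ Finset.range 2, v J s j * lam s ^ r J s j) atTop
        (𝓝 1) := fun s => by
      have h2 := (FloorSemiring.tendsto_pow_div_factorial_atTop (lam s)).const_mul
        (((c s).factorial : ℝ)⁻¹ * lam s ^ c s)
      have h3 := h2.const_add 1
      rw [mul_zero, add_zero] at h3
      convert h3 using 2 with J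
      simp only [Finset.sum_range_succ, v, r, hfac]
      simp only [Finset.range_zero, Finset.sum_empty, if_true, one_ne_zero, if_false, pow_add]
      field_simp
      simp
    have h4 := tendsto_finsetProd Finset.univ fun s _ => h1 s
    simpa using h4.sub_const 1

/-! ### Cycles as pairs of slot cycles and clone cycles. -/

/-- The part of `IsCycle` that concerns the slots only. -/
structure IsSlotCycle {m k : ℕ} (l : ℕ+) (p : Fin (2 * (l : ℕ)) → Fin m × Fin k) : Prop where
  closed : (p (firstPos l)).1 = (p (lastPos l)).1
  start_min : ∀ t, (p (firstPos l)).1 ≤ (p t).1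
  clauses_distinct : ∀ t t' : Fin (2 * (l : ℕ)),
    Even (t : ℕ) → Even (t' : ℕ) → (p t).1 = (p t').1 → t = t'
  clause_step : ∀ t t' : Fin (2 * (l : ℕ)),
    Odd (t : ℕ) → (t' : ℕ) = t + 1 → (p t').1 = (p t).1
  slot_step : ∀ t t' : Fin (2 * (l : ℕ)),
    Odd (t : ℕ) → (t' : ℕ) = t + 1 → (p t').2 ≠ (p t).2
  oriented : (p (firstPos l)).2 < (p (lastPos l)).2

/-- The part of `IsCycle` that concerns the literal clones only. -/
structure IsCloneCycle {n d : ℕ} (s : SignPattern)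
    (f : Fin (2 * (s.1 : ℕ)) → Fin n × Fin d × ℤˣ) : Prop where
  var_step : ∀ t t' : Fin (2 * (s.1 : ℕ)), Even (t : ℕ) → (t' : ℕ) = t + 1 → (f t).1 = (f t').1
  clone_step : ∀ t t' : Fin (2 * (s.1 : ℕ)), Even (t : ℕ) → (t' : ℕ) = t + 1 → f t ≠ f t'
  vars_distinct : ∀ t t' : Fin (2 * (s.1 : ℕ)),
    Even (t : ℕ) → Even (t' : ℕ) → (f t).1 = (f t').1 → t = t'
  signs : ∀ t, (f t).2.2 = s.2 t

/-- `slot_step` and `clone_step` are implied by the conditions of `IsCycle`: a repeated slot would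
identify two distinct variables or two distinct clauses of the cycle or, at the closing clause,
violate the orientation. Making them explicit lets slots and clones be counted independently of `Φ`.
-/
theorem isCycle_iff {m k n d : ℕ} (Φ : Formula m k n d) (s : SignPattern)
    (p : Fin (2 * (s.1 : ℕ)) → Fin m × Fin k) :
    IsCycle Φ s p ↔ IsSlotCycle s.1 p ∧ IsCloneCycle s (Φ ∘ p) := by
  constructor
  · intro h
    have hl := s.1.pos
    refine ⟨⟨h.closed, h.start_min, h.clauses_distinct, h.clause_step, ?_, h.oriented⟩,
      ⟨h.var_step, ?_, h.vars_distinct, h.signs⟩⟩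
    · intro t t' ht htt he
      have h1 : p t' = p t := Prod.ext (h.clause_step t t' ht htt) he
      obtain ⟨r, hr⟩ := ht
      have h2 := h.var_step ⟨2 * r, by omega⟩ t (even_two_mul r) hr
      rw [← h1] at h2
      have h3 := h.vars_distinct _ _ (even_two_mul r) (by rw [htt, hr]; exact ⟨r + 1, by ring⟩) h2
      have := congrArg Fin.val h3
      simp only at this
      omega
    · intro t t' ht htt he
      have h1 : p t = p t' := Φ.injective he
      by_cases hlast : (t' : ℕ) = 2 * (s.1 : ℕ) - 1
      · have h2 : t' = lastPos s.1 := Fin.ext hlast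
        have h3 : (p (firstPos s.1)).1 = (p t).1 := by rw [h.closed, h1, h2]
        have h4 := h.clauses_distinct _ _ (by exact ⟨0, rfl⟩) ht h3
        have := h.oriented
        rw [h4, h1, h2] at this
        exact lt_irrefl _ this
      · have hlt : (t' : ℕ) + 1 < 2 * (s.1 : ℕ) := by have := t'.2; omega
        have h2 := h.clause_step t' ⟨t' + 1, hlt⟩ (by rw [htt]; exact ht.add_one) rfl
        rw [← h1] at h2
        have h3 := h.clauses_distinct _ _
          (by show Even ((t' : ℕ) + 1); rw [htt]; exact ht.add_one.add_one) ht h2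
        have := congrArg Fin.val h3
        simp only at this
        omega
  · rintro ⟨h, g⟩
    exact ⟨h.closed, h.start_min, h.clauses_distinct, h.clause_step, g.var_step, g.vars_distinct,
      h.oriented, g.signs⟩

/-- Every clause of a cycle meets at least two of its slots; this is the source of `2a ≤ e`. -/
theorem IsSlotCycle.exists_partner {m k : ℕ} {l : ℕ+} {p : Fin (2 * (l : ℕ)) → Fin m × Fin k}
    (h : IsSlotCycle l p) (t : Fin (2 * (l : ℕ))) : ∃ t', p t' ≠ p t ∧ (p t').1 = (p t).1 := by
  have hl := l.pos
  have hfl : p (lastPos l) ≠ p (firstPos l) := fun he => by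
    have := h.oriented
    rw [he] at this
    exact lt_irrefl _ this
  rcases Nat.even_or_odd (t : ℕ) with ht | ht
  · by_cases h0 : (t : ℕ) = 0
    · have : t = firstPos l := Fin.ext h0
      exact ⟨lastPos l, by rwa [this], by rw [this, h.closed]⟩
    · obtain ⟨r, hr⟩ := ht
      have hodd : Odd (r + r - 1) := ⟨r - 1, by omega⟩
      have h1 : (t : ℕ) = r + r - 1 + 1 := by omega
      refine ⟨⟨r + r - 1, by omega⟩, fun he => ?_, ?_⟩
      · exact h.slot_step ⟨r + r - 1, by omega⟩ t hodd h1 (by rw [he])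
      · exact (h.clause_step ⟨r + r - 1, by omega⟩ t hodd h1).symm
  · by_cases hlast : (t : ℕ) = 2 * (l : ℕ) - 1
    · have : t = lastPos l := Fin.ext hlast
      exact ⟨firstPos l, by rw [this]; exact hfl.symm, by rw [this, h.closed]⟩
    · have hlt : (t : ℕ) + 1 < 2 * (l : ℕ) := by omega
      exact ⟨⟨t + 1, hlt⟩, fun he => h.slot_step t ⟨t + 1, hlt⟩ ht rfl (by rw [he]),
        h.clause_step t ⟨t + 1, hlt⟩ ht rfl⟩

theorem IsSlotCycle.exists_even {m k : ℕ} {l : ℕ+} {p : Fin (2 * (l : ℕ)) → Fin m × Fin k}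
    (h : IsSlotCycle l p) (t : Fin (2 * (l : ℕ))) :
    ∃ i : Fin (l : ℕ), (p ⟨2 * (i : ℕ), by omega⟩).1 = (p t).1 := by
  have hl := l.pos
  rcases Nat.even_or_odd (t : ℕ) with ⟨r, hr⟩ | ht
  · exact ⟨⟨r, by omega⟩, by congr 2; exact Fin.ext (by simp only; omega)⟩
  · by_cases hlast : (t : ℕ) = 2 * (l : ℕ) - 1
    · have : t = lastPos l := Fin.ext hlast
      exact ⟨⟨0, hl⟩, by rw [this]; exact h.closed⟩
    · obtain ⟨r, hr⟩ := ht
      exact ⟨⟨r + 1, by omega⟩, h.clause_step t ⟨2 * (r + 1), by omega⟩ ⟨r, hr⟩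
        (by simp only; omega)⟩

theorem IsCloneCycle.exists_partner {n d : ℕ} {s : SignPattern}
    {f : Fin (2 * (s.1 : ℕ)) → Fin n × Fin d × ℤˣ} (h : IsCloneCycle s f)
    (t : Fin (2 * (s.1 : ℕ))) : ∃ t', f t' ≠ f t ∧ (f t').1 = (f t).1 := by
  rcases Nat.even_or_odd (t : ℕ) with ⟨r, hr⟩ | ⟨r, hr⟩
  · exact ⟨⟨t + 1, by omega⟩, (h.clone_step t ⟨t + 1, by omega⟩ ⟨r, hr⟩ rfl).symm,
      (h.var_step t ⟨t + 1, by omega⟩ ⟨r, hr⟩ rfl).symm⟩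
  · exact ⟨⟨2 * r, by omega⟩, h.clone_step ⟨2 * r, by omega⟩ t (even_two_mul r) hr,
      h.var_step ⟨2 * r, by omega⟩ t (even_two_mul r) hr⟩

theorem IsCloneCycle.exists_even {n d : ℕ} {s : SignPattern}
    {f : Fin (2 * (s.1 : ℕ)) → Fin n × Fin d × ℤˣ} (h : IsCloneCycle s f)
    (t : Fin (2 * (s.1 : ℕ))) :
    ∃ i : Fin (s.1 : ℕ), (f ⟨2 * (i : ℕ), by omega⟩).1 = (f t).1 := by
  rcases Nat.even_or_odd (t : ℕ) with ⟨r, hr⟩ | ⟨r, hr⟩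
  · exact ⟨⟨r, by omega⟩, by congr 2; exact Fin.ext (by simp only; omega)⟩
  · exact ⟨⟨r, by omega⟩, h.var_step ⟨2 * r, by omega⟩ t (even_two_mul r) hr⟩

/-- Equal clones have equal variables, so both positions lie in the same block `{2i, 2i + 1}`, where
`clone_step` separates them. -/
theorem IsCloneCycle.injective {n d : ℕ} {s : SignPattern}
    {f : Fin (2 * (s.1 : ℕ)) → Fin n × Fin d × ℤˣ} (h : IsCloneCycle s f) :
    Function.Injective f := by
  have key : ∀ t : Fin (2 * (s.1 : ℕ)),
      (f t).1 = (f ⟨2 * ((t : ℕ) / 2), by omega⟩).1 := fun t => by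
    rcases Nat.even_or_odd (t : ℕ) with ⟨r, hr⟩ | ⟨r, hr⟩
    · congr 2; exact Fin.ext (by simp only; omega)
    · exact (h.var_step _ t (even_two_mul _) (by simp only; omega)).symm
  intro t t' he
  have h1 := h.vars_distinct _ _ (even_two_mul _) (even_two_mul _)
    ((key t).symm.trans ((congrArg Prod.fst he).trans (key t')))
  have h2 := congrArg Fin.val h1
  simp only at h2
  by_contra hne
  have hne' : (t : ℕ) ≠ t' := fun h => hne (Fin.ext h)
  rcases Nat.even_or_odd (t : ℕ) with ht | ht
  · refine h.clone_step t t' ht ?_ he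
    have := Nat.even_iff.1 ht
    omega
  · have := Nat.odd_iff.1 ht
    refine h.clone_step t' t (Nat.even_iff.2 (by omega)) (by omega) he.symm

theorem IsCycle.injective {m k n d : ℕ} {Φ : Formula m k n d} {s : SignPattern}
    {p : Fin (2 * (s.1 : ℕ)) → Fin m × Fin k} (h : IsCycle Φ s p) : Function.Injective p :=
  ((isCycle_iff Φ s p).1 h).2.injective.of_comp

/-! ### Overlapping cycles in a 2-regular set of slots. -/

section Fibres

variable {γ β : Type*} [DecidableEq β]

theorem two_mul_card_image_le (P : Finset γ) (g : γ → β)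
    (h : ∀ x ∈ P, ∃ y ∈ P, y ≠ x ∧ g y = g x) : 2 * (P.image g).card ≤ P.card := by
  rw [Finset.card_eq_sum_card_image g P, mul_comm, ← smul_eq_mul]
  refine Finset.card_nsmul_le_sum _ _ _ fun b hb => ?_
  obtain ⟨x, hx, rfl⟩ := Finset.mem_image.1 hb
  obtain ⟨y, hy, hyx, hg⟩ := h x hx
  exact Finset.one_lt_card.2 ⟨y, by simp [hy, hg], x, by simp [hx], hyx⟩

/-- This is the equality case of `two_mul_card_image_le`: all fibres have exactly two elements, so
each element has a unique partner. -/
theorem eq_of_card_le_two_mul_card_image [DecidableEq γ] (P : Finset γ) (g : γ → β)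
    (h : ∀ x ∈ P, ∃ y ∈ P, y ≠ x ∧ g y = g x) (hP : P.card ≤ 2 * (P.image g).card)
    {x y z : γ} (hx : x ∈ P) (hy : y ∈ P) (hz : z ∈ P) (hxy : g y = g x) (hxz : g z = g x)
    (hy' : y ≠ x) (hz' : z ≠ x) : y = z := by
  by_contra hyz
  have h2 : ∀ b ∈ P.image g, 2 ≤ (P.filter (g · = b)).card := fun b hb => by
    obtain ⟨x, hx, rfl⟩ := Finset.mem_image.1 hb
    obtain ⟨y, hy, hyx, hg⟩ := h x hx
    exact Finset.one_lt_card.2 ⟨y, by simp [hy, hg], x, by simp [hx], hyx⟩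
  have h3 : 2 < (P.filter (g · = g x)).card :=
    Finset.two_lt_card.2 ⟨y, by simp [hy, hxy], z, by simp [hz, hxz], x, by simp [hx], hyz, hy', hz'⟩
  have h4 := Finset.sum_lt_sum h2 ⟨g x, Finset.mem_image_of_mem g hx, h3⟩
  rw [← Finset.card_eq_sum_card_image g P, Finset.sum_const, smul_eq_mul] at h4
  omega

end Fibres

/-- A cycle is connected: the property moves forward to the last position, through the closing
clause to the first, and forward again. -/
theorem IsCycle.forall_of_exists {m k n d : ℕ} {Φ : Formula m k n d} {s : SignPattern}
    {p : Fin (2 * (s.1 : ℕ)) → Fin m × Fin k} (h : IsCycle Φ s p) {R : Fin m × Fin k → Prop}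
    (h1 : ∀ t t', (p t').1 = (p t).1 → R (p t) → R (p t'))
    (h2 : ∀ t t', Φ.var (p t') = Φ.var (p t) → R (p t) → R (p t'))
    (t₀ : Fin (2 * (s.1 : ℕ))) (h0 : R (p t₀)) (t : Fin (2 * (s.1 : ℕ))) : R (p t) := by
  have up : ∀ t₀ : Fin (2 * (s.1 : ℕ)), R (p t₀) →
      ∀ i (hi : i < 2 * (s.1 : ℕ)), (t₀ : ℕ) ≤ i → R (p ⟨i, hi⟩) := by
    intro t₀ h0 i hi hle
    induction i, hle using Nat.le_induction with
    | base => exact h0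
    | succ i hle ih =>
      have hi' : i < 2 * (s.1 : ℕ) := by omega
      rcases Nat.even_or_odd i with he | ho
      · exact h2 _ _ (h.var_step ⟨i, hi'⟩ ⟨i + 1, hi⟩ he rfl).symm (ih hi')
      · exact h1 _ _ (h.clause_step ⟨i, hi'⟩ ⟨i + 1, hi⟩ ho rfl) (ih hi')
  have hlast : R (p (lastPos s.1)) := up t₀ h0 _ _ (by have := t₀.2; omega)
  have hfirst : R (p (firstPos s.1)) := h1 _ _ h.closed hlast
  exact up _ hfirst t t.2 (Nat.zero_le _)

/-- In a set of slots that meets every clause and every variable at most twice, two cycles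
that share a slot coincide. -/
theorem IsCycle.eq_of_share_slot {m k n d : ℕ} {Φ : Formula m k n d} {P : Finset (Fin m × Fin k)}
    (hclause : ∀ {x y z}, x ∈ P → y ∈ P → z ∈ P → y.1 = x.1 → z.1 = x.1 → y ≠ x → z ≠ x → y = z)
    (hvar : ∀ {x y z}, x ∈ P → y ∈ P → z ∈ P → Φ.var y = Φ.var x → Φ.var z = Φ.var x →
      y ≠ x → z ≠ x → y = z)
    {s s' : SignPattern} {p : Fin (2 * (s.1 : ℕ)) → Fin m × Fin k}
    {p' : Fin (2 * (s'.1 : ℕ)) → Fin m × Fin k} (h : IsCycle Φ s p) (h' : IsCycle Φ s' p')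
    (hp : ∀ t, p t ∈ P) (hp' : ∀ t, p' t ∈ P) {t₀ : Fin (2 * (s.1 : ℕ))}
    {t₀' : Fin (2 * (s'.1 : ℕ))} (h0 : p t₀ = p' t₀') :
    (⟨s, p⟩ : Σ s : SignPattern, (Fin (2 * (s.1 : ℕ)) → Fin m × Fin k)) = ⟨s', p'⟩ := by
  -- The partner of a slot within the second cycle is its only partner in `P`, so the first cycle
  -- cannot leave the slots of the second.
  have sub : ∀ {s s' : SignPattern} {p : Fin (2 * (s.1 : ℕ)) → Fin m × Fin k}
      {p' : Fin (2 * (s'.1 : ℕ)) → Fin m × Fin k}, IsCycle Φ s p → IsCycle Φ s' p' →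
      (∀ t, p t ∈ P) → (∀ t, p' t ∈ P) → ∀ {t₀ : Fin (2 * (s.1 : ℕ))} {t₀'}, p t₀ = p' t₀' →
      ∀ t, ∃ t', p' t' = p t := by
    intro s s' p p' h h' hp hp' t₀ t₀' h0 t
    obtain ⟨hs, hf⟩ := (isCycle_iff Φ s' p').1 h'
    refine h.forall_of_exists (R := fun x => ∃ t', p' t' = x) ?_ ?_ t₀ ⟨t₀', h0.symm⟩ t
    · rintro t t' he ⟨r, hr⟩
      by_cases hne : p t' = p t
      · exact ⟨r, by rw [hr, hne]⟩
      · obtain ⟨r', hr1, hr2⟩ := hs.exists_partner r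
        rw [hr] at hr1 hr2
        exact ⟨r', hclause (hp t) (hp' r') (hp t') hr2 he hr1 hne⟩
    · rintro t t' he ⟨r, hr⟩
      by_cases hne : p t' = p t
      · exact ⟨r, by rw [hr, hne]⟩
      · obtain ⟨r', hr1, hr2⟩ := hf.exists_partner r
        simp only [Function.comp_apply, hr] at hr1 hr2
        exact ⟨r', hvar (hp t) (hp' r') (hp t') hr2 he (fun e => hr1 (by rw [e])) hne⟩
  have s1 := sub h h' hp hp' h0
  have s2 := sub h' h hp' hp h0.symm
  have hr : Finset.univ.image p = Finset.univ.image p' := by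
    ext x
    simp only [Finset.mem_image, Finset.mem_univ, true_and]
    constructor
    · rintro ⟨t, rfl⟩; exact s1 t
    · rintro ⟨t, rfl⟩; exact s2 t
  have hcard := congrArg Finset.card hr
  rw [Finset.card_image_of_injective _ h.injective, Finset.card_image_of_injective _ h'.injective,
    Finset.card_univ, Finset.card_univ, Fintype.card_fin, Fintype.card_fin] at hcard
  obtain ⟨l, s⟩ := s
  obtain ⟨l', s'⟩ := s'
  have hll : l = l' := PNat.eq (by simp only at hcard; omega)
  subst hll
  -- Both cycles use the same slots and start at the clause of smallest index.
  have hc : (p (firstPos l)).1 = (p' (firstPos l)).1 := by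
    obtain ⟨t, ht⟩ := s1 (firstPos l)
    obtain ⟨t', ht'⟩ := s2 (firstPos l)
    refine le_antisymm ?_ ?_
    · rw [← ht']; exact h.start_min _
    · rw [← ht]; exact h'.start_min _
  have hne : p (lastPos l) ≠ p (firstPos l) := fun e => by
    have := h.oriented; simp only [e, lt_irrefl] at this
  have hne' : p' (lastPos l) ≠ p' (firstPos l) := fun e => by
    have := h'.oriented; simp only [e, lt_irrefl] at this
  have hcl : (p (firstPos l)).1 = (p (lastPos l)).1 := h.closed
  have hcl' : (p' (firstPos l)).1 = (p' (lastPos l)).1 := h'.closed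
  -- The common initial clause has only two slots in `P`; traversing them in opposite order
  -- contradicts the orientation of one cycle.
  have hfirst : p (firstPos l) = p' (firstPos l) := by
    by_contra hn
    have e1 : p (lastPos l) = p' (firstPos l) :=
      hclause (hp _) (hp _) (hp' _) hcl.symm hc.symm hne (Ne.symm hn)
    have e2 : p (firstPos l) = p' (lastPos l) :=
      hclause (hp' (firstPos l)) (hp _) (hp' _) hc hcl'.symm hn hne'
    have o1 : (p (firstPos l)).2 < (p (lastPos l)).2 := h.oriented
    have o2 : (p' (firstPos l)).2 < (p' (lastPos l)).2 := h'.oriented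
    rw [← e1, ← e2] at o2
    exact lt_asymm o1 o2
  -- Each further slot is the unique partner of the previous one, alternately in its variable and in
  -- its clause.
  have hall : ∀ i (hi : i < 2 * (l : ℕ)), p ⟨i, hi⟩ = p' ⟨i, hi⟩ := by
    intro i
    induction i with
    | zero => intro _; exact hfirst
    | succ i ih =>
      intro hi
      have hi' : i < 2 * (l : ℕ) := by omega
      have n1 : p ⟨i + 1, hi⟩ ≠ p ⟨i, hi'⟩ := fun e => by
        have := congrArg Fin.val (h.injective e); simp at this
      have n2 : p' ⟨i + 1, hi⟩ ≠ p' ⟨i, hi'⟩ := fun e => by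
        have := congrArg Fin.val (h'.injective e); simp at this
      rw [← ih hi'] at n2
      rcases Nat.even_or_odd i with he | ho
      · refine hvar (hp ⟨i, hi'⟩) (hp _) (hp' _) ?_ ?_ n1 n2
        · exact (h.var_step ⟨i, hi'⟩ ⟨i + 1, hi⟩ he rfl).symm
        · rw [ih hi']; exact (h'.var_step ⟨i, hi'⟩ ⟨i + 1, hi⟩ he rfl).symm
      · refine hclause (hp ⟨i, hi'⟩) (hp _) (hp' _) ?_ ?_ n1 n2
        · exact h.clause_step ⟨i, hi'⟩ ⟨i + 1, hi⟩ ho rfl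
        · rw [ih hi']; exact h'.clause_step ⟨i, hi'⟩ ⟨i + 1, hi⟩ ho rfl
  have hpp : p = p' := funext fun t => hall t t.2
  subst hpp
  have hss : s = s' := funext fun t => (h.signs t).symm.trans (h'.signs t)
  subst hss
  rfl

/-! ### Families of cycles and the size of their union. -/

/-- The number of distinct first components of a family of pairs. -/
def fstCard {I α β : Type*} [Fintype I] [DecidableEq α] (f : I → α × β) : ℕ :=
  (Finset.univ.image fun i => (f i).1).card

/-- The number of distinct members of a family. -/
def imageCard {I α : Type*} [Fintype I] [DecidableEq α] (f : I → α) : ℕ :=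
  (Finset.univ.image f).card

section General

variable {I α β : Type*} [Fintype I] [DecidableEq α]

theorem imageCard_le (f : I → α) : imageCard f ≤ Fintype.card I :=
  Finset.card_image_le

theorem injective_of_card_le_imageCard {f : I → α} (h : Fintype.card I ≤ imageCard f) :
    Function.Injective f := by
  classical
  have := Finset.card_image_iff.1 (le_antisymm (imageCard_le f) h)
  simpa [Set.injOn_univ] using this

theorem imageCard_of_injective {f : I → α} (h : Function.Injective f) :
    imageCard f = Fintype.card I :=
  Finset.card_image_of_injective _ h

theorem fstCard_eq_card_image_image [DecidableEq β] (f : I → α × β) :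
    fstCard f = ((Finset.univ.image f).image Prod.fst).card := by
  rw [Finset.image_image]; rfl

theorem two_mul_fstCard_le [DecidableEq β] {f : I → α × β} (h : ∀ i, ∃ i', f i' ≠ f i ∧ (f i').1 = (f i).1) :
    2 * fstCard f ≤ imageCard f := by
  rw [fstCard_eq_card_image_image]
  refine two_mul_card_image_le _ _ fun x hx => ?_
  obtain ⟨i, -, rfl⟩ := Finset.mem_image.1 hx
  obtain ⟨i', h1, h2⟩ := h i
  exact ⟨f i', Finset.mem_image_of_mem _ (Finset.mem_univ _), h1, h2⟩

theorem fstCard_le_card_of_forall_exists {J : Type*} [Fintype J] {f : I → α × β} (g : J → I)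
    (h : ∀ i, ∃ j, (f (g j)).1 = (f i).1) : fstCard f ≤ Fintype.card J := by
  have : (Finset.univ.image fun i => (f i).1) ⊆ Finset.univ.image fun j => (f (g j)).1 := by
    intro x hx
    obtain ⟨i, -, rfl⟩ := Finset.mem_image.1 hx
    obtain ⟨j, hj⟩ := h i
    exact Finset.mem_image.2 ⟨j, Finset.mem_univ _, hj⟩
  exact (Finset.card_le_card this).trans Finset.card_image_le

end General

section Families

variable {T : Type*} (σ : T → SignPattern)

/-- The positions of a family of cycles with sign patterns `σ`. -/
abbrev Pos : Type _ := Σ τ : T, Fin (2 * ((σ τ).1 : ℕ))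

variable {m k n d : ℕ}

/-- A family of slot cycles. -/
def IsSlotFamily (q : Pos σ → Fin m × Fin k) : Prop :=
  ∀ τ, IsSlotCycle (σ τ).1 fun t => q ⟨τ, t⟩

/-- A family of clone cycles. -/
def IsCloneFamily (f : Pos σ → Fin n × Fin d × ℤˣ) : Prop :=
  ∀ τ, IsCloneCycle (σ τ) fun t => f ⟨τ, t⟩

/-- A family of distinct cycles. -/
def IsCycleFamily (Φ : Formula m k n d) (q : Pos σ → Fin m × Fin k) : Prop :=
  (∀ τ, IsCycle Φ (σ τ) fun t => q ⟨τ, t⟩) ∧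
    Function.Injective fun τ =>
      (⟨σ τ, fun t => q ⟨τ, t⟩⟩ : Σ s : SignPattern, (Fin (2 * (s.1 : ℕ)) → Fin m × Fin k))

variable {σ}

theorem forall_isCycle_iff (Φ : Formula m k n d) (q : Pos σ → Fin m × Fin k) :
    (∀ τ, IsCycle Φ (σ τ) fun t => q ⟨τ, t⟩) ↔ IsSlotFamily σ q ∧ IsCloneFamily σ (Φ ∘ q) := by
  simp_rw [isCycle_iff, forall_and]
  rfl

theorem isCycleFamily_of_injective {Φ : Formula m k n d} {q : Pos σ → Fin m × Fin k}
    (h : IsSlotFamily σ q) (h' : IsCloneFamily σ (Φ ∘ q)) (hq : Function.Injective q) :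
    IsCycleFamily σ Φ q := by
  refine ⟨(forall_isCycle_iff Φ q).2 ⟨h, h'⟩, fun τ τ' he => ?_⟩
  have h1 := congrArg
    (fun x : Σ s : SignPattern, (Fin (2 * (s.1 : ℕ)) → Fin m × Fin k) => x.2 (firstPos x.1.1)) he
  exact congrArg Sigma.fst (hq h1)

variable [Fintype T]

/-- The total number of clauses of a family of disjoint cycles with sign patterns `σ`. -/
def totalLen (σ : T → SignPattern) : ℕ := ∑ τ, ((σ τ).1 : ℕ)

theorem card_pos (σ : T → SignPattern) : Fintype.card (Pos σ) = 2 * totalLen σ := by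
  simp [Pos, totalLen, Finset.mul_sum]

theorem IsSlotFamily.two_mul_fstCard_le {q : Pos σ → Fin m × Fin k} (h : IsSlotFamily σ q) :
    2 * fstCard q ≤ imageCard q :=
  RegularKSAT.two_mul_fstCard_le fun ⟨τ, t⟩ =>
    let ⟨t', ht⟩ := (h τ).exists_partner t
    ⟨⟨τ, t'⟩, ht⟩

theorem IsCloneFamily.two_mul_fstCard_le {f : Pos σ → Fin n × Fin d × ℤˣ}
    (h : IsCloneFamily σ f) : 2 * fstCard f ≤ imageCard f :=
  RegularKSAT.two_mul_fstCard_le fun ⟨τ, t⟩ =>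
    let ⟨t', ht⟩ := (h τ).exists_partner t
    ⟨⟨τ, t'⟩, ht⟩

theorem IsSlotFamily.fstCard_le {q : Pos σ → Fin m × Fin k} (h : IsSlotFamily σ q) :
    fstCard q ≤ totalLen σ := by
  refine (fstCard_le_card_of_forall_exists
    (fun j : Σ τ, Fin ((σ τ).1 : ℕ) => ⟨j.1, ⟨2 * (j.2 : ℕ), by omega⟩⟩) ?_).trans
    (by simp [totalLen])
  rintro ⟨τ, t⟩
  obtain ⟨i, hi⟩ := (h τ).exists_even t
  exact ⟨⟨τ, i⟩, hi⟩

theorem IsCloneFamily.fstCard_le {f : Pos σ → Fin n × Fin d × ℤˣ} (h : IsCloneFamily σ f) :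
    fstCard f ≤ totalLen σ := by
  refine (fstCard_le_card_of_forall_exists
    (fun j : Σ τ, Fin ((σ τ).1 : ℕ) => ⟨j.1, ⟨2 * (j.2 : ℕ), by omega⟩⟩) ?_).trans
    (by simp [totalLen])
  rintro ⟨τ, t⟩
  obtain ⟨i, hi⟩ := (h τ).exists_even t
  exact ⟨⟨τ, i⟩, hi⟩

/-- `totalLen σ` clauses force at least `2 * totalLen σ` distinct slots, which is the number of
positions. -/
theorem IsSlotFamily.injective {q : Pos σ → Fin m × Fin k} (h : IsSlotFamily σ q)
    (hL : fstCard q = totalLen σ) : Function.Injective q :=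
  injective_of_card_le_imageCard (by rw [card_pos, ← hL]; exact h.two_mul_fstCard_le)

theorem IsCloneFamily.injective {f : Pos σ → Fin n × Fin d × ℤˣ} (h : IsCloneFamily σ f)
    (hL : fstCard f = totalLen σ) : Function.Injective f :=
  injective_of_card_le_imageCard (by rw [card_pos, ← hL]; exact h.two_mul_fstCard_le)

theorem imageCard_comp_equiv (Φ : Formula m k n d) (q : Pos σ → Fin m × Fin k) :
    imageCard (Φ ∘ q) = imageCard q := by
  unfold imageCard
  rw [← Finset.image_image, Finset.card_image_of_injective _ Φ.injective]

/-- A family of distinct cycles is either vertex-disjoint, or its union has more edges than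
vertices. -/
theorem IsCycleFamily.disjoint_or_lt {Φ : Formula m k n d} {q : Pos σ → Fin m × Fin k}
    (h : IsCycleFamily σ Φ q) :
    (fstCard q = totalLen σ ∧ fstCard (Φ ∘ q) = totalLen σ) ∨
      fstCard q + fstCard (Φ ∘ q) < imageCard q := by
  obtain ⟨hs, hf⟩ := (forall_isCycle_iff Φ q).1 h.1
  have h1 := hs.two_mul_fstCard_le
  have h2 := hf.two_mul_fstCard_le
  rw [imageCard_comp_equiv] at h2
  -- With `2a ≤ e` and `2v ≤ e`, the assumption `e ≤ a + v` forces `2a = 2v = e`, so every clause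
  -- and every variable meets exactly two slots of the union.
  by_contra! hcon
  obtain ⟨hne, hle⟩ := hcon
  let P := Finset.univ.image q
  have hmem : ∀ i, q i ∈ P := fun i => Finset.mem_image_of_mem _ (Finset.mem_univ _)
  have hv : fstCard (Φ ∘ q) = (P.image Φ.var).card := by
    rw [Finset.image_image]; rfl
  -- Distinct cycles are then slot-disjoint, so `e = 2 * totalLen σ` and `a = v = totalLen σ`.
  have hinj : Function.Injective q := by
    rintro ⟨τ, t⟩ ⟨τ', t'⟩ he
    have hττ : τ = τ' := by
      refine h.2 (IsCycle.eq_of_share_slot (Φ := Φ) (P := P) ?_ ?_ (h.1 τ) (h.1 τ')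
        (fun t => hmem ⟨τ, t⟩) (fun t => hmem ⟨τ', t⟩) he)
      · intro x y z hx hy hz e1 e2 n1 n2
        refine eq_of_card_le_two_mul_card_image P Prod.fst ?_ ?_ hx hy hz e1 e2 n1 n2
        · intro x hx
          obtain ⟨⟨τ, t⟩, -, rfl⟩ := Finset.mem_image.1 hx
          obtain ⟨t', ht⟩ := (hs τ).exists_partner t
          exact ⟨_, hmem ⟨τ, t'⟩, ht⟩
        · rw [← fstCard_eq_card_image_image]
          change imageCard q ≤ _
          omega
      · intro x y z hx hy hz e1 e2 n1 n2
        refine eq_of_card_le_two_mul_card_image P Φ.var ?_ ?_ hx hy hz e1 e2 n1 n2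
        · intro x hx
          obtain ⟨⟨τ, t⟩, -, rfl⟩ := Finset.mem_image.1 hx
          obtain ⟨t', ht⟩ := (hf τ).exists_partner t
          exact ⟨_, hmem ⟨τ, t'⟩, fun e => ht.1 (congrArg Φ e), ht.2⟩
        · rw [← hv]
          change imageCard q ≤ _
          omega
    subst hττ
    rw [(h.1 τ).injective he]
  have h3 := imageCard_of_injective hinj
  rw [card_pos] at h3
  exact hne (by omega) (by omega)

end Families

/-! ### Counting assignments and the bijections that extend them. -/

section Counting

/-- The number of maps `I → α × β` with exactly `a` distinct first components is `O(|α|^a)`. -/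
theorem card_fstCard_eq_le {I α β : Type*} [Fintype I] [DecidableEq I] [Fintype α] [DecidableEq α]
    [Fintype β] [DecidableEq β] (a : ℕ) :
    (Finset.univ.filter fun f : I → α × β => fstCard f = a).card
      ≤ a ^ Fintype.card I * Fintype.card β ^ Fintype.card I * Fintype.card α ^ a := by
  have hcard : Fintype.card ((I → Fin a) × (I → β) × (Fin a → α))
      = a ^ Fintype.card I * Fintype.card β ^ Fintype.card I * Fintype.card α ^ a := by
    simp [mul_assoc]
  rw [← hcard, ← Finset.card_univ]
  -- The map is recovered from a labelling of `I` by `a` labels, the second components, and the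
  -- first component belonging to each label.
  refine Finset.card_le_card_of_surjOn
    (fun x : (I → Fin a) × (I → β) × (Fin a → α) => fun i => (x.2.2 (x.1 i), x.2.1 i)) ?_
  intro f hf
  have hf' : (Finset.univ.image fun i => (f i).1).card = a :=
    (Finset.mem_filter.1 hf).2
  let e := (Finset.univ.image fun i => (f i).1).equivFinOfCardEq hf'
  refine ⟨(fun i => e ⟨(f i).1, by simp⟩, fun i => (f i).2, fun j => (e.symm j).1), by simp, ?_⟩
  funext i
  simp

/-- The number of bijections that extend a given injective assignment. -/
theorem card_equiv_extending {I X Y : Type*} [Fintype I] [Fintype X] [DecidableEq X] [Fintype Y]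
    [DecidableEq Y] {q : I → X} (hq : Function.Injective q) {f : I → Y} (Φ₀ : X ≃ Y)
    (h0 : ⇑Φ₀ ∘ q = f) :
    (Finset.univ.filter fun Φ : X ≃ Y => ⇑Φ ∘ q = f).card
      = (Fintype.card X - Fintype.card I).factorial := by
  classical
  -- Composition with the inverse of `Φ₀` turns extensions into permutations that fix the range of
  -- `q`.
  have e1 : {Φ : X ≃ Y // ⇑Φ ∘ q = f} ≃
      {g : Equiv.Perm X // ∀ x, ¬ (x ∉ Set.range q) → g x = x} :=
    { toFun := fun Φ => ⟨Φ.1.trans Φ₀.symm, by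
        intro x hx
        obtain ⟨i, rfl⟩ := not_not.1 hx
        have h1 : Φ.1 (q i) = f i := congrFun Φ.2 i
        have h2 : Φ₀ (q i) = f i := congrFun h0 i
        simp [h1, ← h2]⟩
      invFun := fun g => ⟨g.1.trans Φ₀, by
        funext i
        have h2 : Φ₀ (q i) = f i := congrFun h0 i
        simp [g.2 (q i) (by simp), h2]⟩
      left_inv := fun Φ => by ext; simp
      right_inv := fun g => by ext; simp }
  rw [← Fintype.card_subtype, Fintype.card_congr e1,
    ← Fintype.card_congr (Equiv.Perm.subtypeEquivSubtypePerm fun x => x ∉ Set.range q),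
    Fintype.card_perm, Fintype.card_subtype_compl]
  congr 2
  rw [Set.card_range_of_injective hq]

/-- For `q` with repetitions, the assignment either is contradictory or prescribes the bijection
exactly on the image of `q`. -/
theorem card_equiv_extending_le {I X Y : Type*} [Fintype I] [Fintype X] [DecidableEq X]
    [Fintype Y] [DecidableEq Y] (q : I → X) (f : I → Y) :
    (Finset.univ.filter fun Φ : X ≃ Y => ⇑Φ ∘ q = f).card
      ≤ (Fintype.card X - imageCard q).factorial := by
  classical
  have hex : ∀ x : Finset.univ.image q, ∃ i, q i = x := fun x => by
    obtain ⟨i, -, hi⟩ := Finset.mem_image.1 x.2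
    exact ⟨i, hi⟩
  choose g hg using hex
  by_cases hne : ∃ Φ₀ : X ≃ Y, ⇑Φ₀ ∘ q = f
  · obtain ⟨Φ₀, h0⟩ := hne
    have h1 := card_equiv_extending (I := Finset.univ.image q) (q := fun x => (x : X))
      Subtype.val_injective (f := fun x => f (g x)) Φ₀
      (by funext x; rw [← h0]; simp [hg])
    rw [Fintype.card_coe] at h1
    unfold imageCard
    rw [← h1]
    refine Finset.card_le_card fun Φ => ?_
    simp only [Finset.mem_filter, Finset.mem_univ, true_and]
    intro h
    funext x
    rw [← h]
    simp [hg]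
  · rw [Finset.filter_eq_empty_iff.2 fun Φ _ h => hne ⟨Φ, h⟩]
    simp

theorem exists_equiv_extending {I X Y : Type*} [Fintype I] [Fintype X] [Fintype Y]
    (hXY : Fintype.card X = Fintype.card Y) {q : I → X} (hq : Function.Injective q) {f : I → Y}
    (hf : Function.Injective f) : ∃ Φ : X ≃ Y, ⇑Φ ∘ q = f := by
  classical
  let e := Fintype.equivOfCardEq hXY
  let r : {x // x ∈ Set.range (e ∘ q)} ≃ {y // y ∈ Set.range f} :=
    (Equiv.ofInjective (e ∘ q) (e.injective.comp hq)).symm.trans (Equiv.ofInjective f hf)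
  refine ⟨e.trans r.extendSubtype, ?_⟩
  funext i
  have h := r.extendSubtype_apply_of_mem (e (q i)) ⟨i, rfl⟩
  simp only [Function.comp_apply, Equiv.trans_apply]
  rw [h]
  have : (Equiv.ofInjective (e ∘ q) (e.injective.comp hq)).symm ⟨e (q i), ⟨i, rfl⟩⟩ = i :=
    Equiv.ofInjective_symm_apply (e.injective.comp hq) i
  simp [r, this]

end Counting

/-! ### Exact numbers of slot cycles and clone cycles. -/

theorem card_ne_pairs (k : ℕ) :
    Nat.card {x : Fin k × Fin k // x.1 ≠ x.2} = k * (k - 1) := by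
  rw [Nat.card_eq_fintype_card, Fintype.card_subtype]
  have : (Finset.univ.filter fun x : Fin k × Fin k => x.1 ≠ x.2)
      = (Finset.univ : Finset (Fin k)).offDiag := by ext; simp
  rw [this, Finset.offDiag_card, Finset.card_univ, Fintype.card_fin, Nat.mul_sub_one]

theorem two_mul_card_lt_pairs (k : ℕ) :
    2 * Nat.card {x : Fin k × Fin k // x.1 < x.2} = k * (k - 1) := by
  have e : {x : Fin k × Fin k // x.1 ≠ x.2} ≃
      {x : Fin k × Fin k // x.1 < x.2} ⊕ {x : Fin k × Fin k // x.2 < x.1} :=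
    (Equiv.subtypeEquivRight fun x => ne_iff_lt_or_gt).trans
      (subtypeOrEquiv _ _ (by
        rw [Pi.disjoint_iff]; intro x
        rw [Prop.disjoint_iff, not_and]; exact fun h => lt_asymm h))
  have e2 : {x : Fin k × Fin k // x.2 < x.1} ≃ {x : Fin k × Fin k // x.1 < x.2} :=
    (Equiv.prodComm _ _).subtypeEquiv fun _ => Iff.rfl
  rw [← card_ne_pairs, Nat.card_congr e, Nat.card_sum, Nat.card_congr e2]
  ring

/-- The number of injections that attain their minimum at a given point. -/
theorem card_embedding_min {l : ℕ} (m : ℕ) (j₀ : Fin l) :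
    l * Nat.card {f : Fin l ↪ Fin m // ∀ i, f j₀ ≤ f i} = m.descFactorial l := by
  -- Every injection attains its minimum at exactly one index, and by symmetry all indices are
  -- equally frequent.
  have e : (Σ j : Fin l, {f : Fin l ↪ Fin m // ∀ i, f j ≤ f i}) ≃ (Fin l ↪ Fin m) :=
    Equiv.ofBijective (fun x => x.2.1) (by
      constructor
      · rintro ⟨j, f, hf⟩ ⟨j', f', hf'⟩ h
        simp only at h
        subst h
        have : j = j' := f.injective (le_antisymm (hf _) (hf' _))
        subst this
        rfl
      · intro f
        have : Nonempty (Fin l) := ⟨j₀⟩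
        obtain ⟨j, hj⟩ := Finite.exists_min f
        exact ⟨⟨j, f, hj⟩, rfl⟩)
  have h1 : ∀ j : Fin l, Nat.card {f : Fin l ↪ Fin m // ∀ i, f j ≤ f i}
      = Nat.card {f : Fin l ↪ Fin m // ∀ i, f j₀ ≤ f i} := fun j => by
    refine Nat.card_congr (((Equiv.swap j₀ j).embeddingCongr (Equiv.refl _)).subtypeEquiv ?_)
    intro f
    constructor
    · intro h i
      simpa using h (Equiv.swap j₀ j i)
    · intro h i
      simpa using h (Equiv.swap j₀ j i)
  have h2 := Nat.card_congr e
  rw [Nat.card_sigma, Finset.sum_congr rfl fun j _ => h1 j, Finset.sum_const, Finset.card_univ,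
    Fintype.card_fin, smul_eq_mul] at h2
  rw [h2, Nat.card_eq_fintype_card, Fintype.card_embedding_eq, Fintype.card_fin, Fintype.card_fin]

/-- The condition on the two slots of a cycle in its `i`-th clause. -/
def SlotPair {l k : ℕ} (i : Fin l) (x : Fin k × Fin k) : Prop :=
  if (i : ℕ) = 0 then x.1 < x.2 else x.1 ≠ x.2

/-- The orientation halves the number of slot pairs in the initial clause only. -/
theorem two_mul_prod_card_slotPair (l : ℕ+) (k : ℕ) :
    2 * ∏ i : Fin (l : ℕ), Nat.card {x : Fin k × Fin k // SlotPair i x}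
      = (k * (k - 1)) ^ (l : ℕ) := by
  have h0 : 2 * Nat.card {x : Fin k × Fin k // SlotPair (⟨0, l.pos⟩ : Fin (l : ℕ)) x}
      = k * (k - 1) := by
    simpa [SlotPair] using two_mul_card_lt_pairs k
  rw [← Finset.mul_prod_erase _ _ (Finset.mem_univ (⟨0, l.pos⟩ : Fin (l : ℕ))), ← mul_assoc, h0]
  have h1 : ∀ i ∈ Finset.univ.erase (⟨0, l.pos⟩ : Fin (l : ℕ)),
      Nat.card {x : Fin k × Fin k // SlotPair i x} = k * (k - 1) := fun i hi => by
    have : (i : ℕ) ≠ 0 := fun h => (Finset.mem_erase.1 hi).1 (Fin.ext h)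
    simpa [SlotPair, this] using card_ne_pairs k
  rw [Finset.prod_congr rfl h1, Finset.prod_const, ← pow_succ',
    Finset.card_erase_add_one (Finset.mem_univ _), Finset.card_univ, Fintype.card_fin]

/-- The number of the clause at a position of a cycle. -/
def clauseIdx (l : ℕ+) (t : Fin (2 * (l : ℕ))) : Fin (l : ℕ) :=
  if h : (t : ℕ) = 2 * (l : ℕ) - 1 then ⟨0, l.pos⟩ else ⟨((t : ℕ) + 1) / 2, by omega⟩

/-- The position at which a cycle leaves its `i`-th clause. -/
def outPos (l : ℕ+) (i : Fin (l : ℕ)) : Fin (2 * (l : ℕ)) := ⟨2 * (i : ℕ), by omega⟩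

/-- The position at which a cycle enters its `i`-th clause. -/
def inPos (l : ℕ+) (i : Fin (l : ℕ)) : Fin (2 * (l : ℕ)) :=
  ⟨if (i : ℕ) = 0 then 2 * (l : ℕ) - 1 else 2 * (i : ℕ) - 1, by
    have := i.2; split_ifs <;> omega⟩

theorem clauseIdx_outPos (l : ℕ+) (i : Fin (l : ℕ)) : clauseIdx l (outPos l i) = i := by
  unfold clauseIdx outPos
  split_ifs with h
  · simp only at h; omega
  · exact Fin.ext (by simp only; omega)

theorem clauseIdx_inPos (l : ℕ+) (i : Fin (l : ℕ)) : clauseIdx l (inPos l i) = i := by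
  have := i.2
  refine Fin.ext ?_
  by_cases hi : (i : ℕ) = 0
  · simp [clauseIdx, inPos, hi]
  · have h : 2 * (i : ℕ) - 1 ≠ 2 * (l : ℕ) - 1 := by omega
    simp only [clauseIdx, inPos, if_neg hi, dif_neg h]
    omega

theorem outPos_clauseIdx {l : ℕ+} {t : Fin (2 * (l : ℕ))} (ht : Even (t : ℕ)) :
    outPos l (clauseIdx l t) = t := by
  have := Nat.even_iff.1 ht
  have := t.2
  refine Fin.ext ?_
  unfold clauseIdx outPos
  split_ifs with h
  · omega
  · simp only; omega

theorem inPos_clauseIdx {l : ℕ+} {t : Fin (2 * (l : ℕ))} (ht : Odd (t : ℕ)) :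
    inPos l (clauseIdx l t) = t := by
  have := Nat.odd_iff.1 ht
  have := t.2
  refine Fin.ext ?_
  by_cases h : (t : ℕ) = 2 * (l : ℕ) - 1
  · simp [clauseIdx, inPos, h]
  · simp only [clauseIdx, inPos, dif_neg h]
    split_ifs with h1 <;> omega

theorem even_outPos (l : ℕ+) (i : Fin (l : ℕ)) : Even ((outPos l i : Fin _) : ℕ) :=
  even_two_mul _

theorem odd_inPos (l : ℕ+) (i : Fin (l : ℕ)) : Odd ((inPos l i : Fin _) : ℕ) := by
  have := i.2
  rw [Nat.odd_iff]
  unfold inPos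
  simp only
  split_ifs <;> omega

theorem firstPos_eq_outPos (l : ℕ+) : firstPos l = outPos l ⟨0, l.pos⟩ := rfl

theorem lastPos_eq_inPos (l : ℕ+) : lastPos l = inPos l ⟨0, l.pos⟩ := by
  simp [lastPos, inPos]

theorem clauseIdx_firstPos (l : ℕ+) : clauseIdx l (firstPos l) = ⟨0, l.pos⟩ :=
  clauseIdx_outPos l ⟨0, l.pos⟩

theorem clauseIdx_lastPos (l : ℕ+) : clauseIdx l (lastPos l) = ⟨0, l.pos⟩ := by
  rw [lastPos_eq_inPos, clauseIdx_inPos]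

theorem even_firstPos (l : ℕ+) : Even ((firstPos l : Fin _) : ℕ) := ⟨0, rfl⟩

theorem not_even_lastPos (l : ℕ+) : ¬ Even ((lastPos l : Fin _) : ℕ) := by
  rw [lastPos_eq_inPos, Nat.not_even_iff_odd]
  exact odd_inPos _ _

theorem IsSlotCycle.fst_inPos {m k : ℕ} {l : ℕ+} {p : Fin (2 * (l : ℕ)) → Fin m × Fin k}
    (h : IsSlotCycle l p) (i : Fin (l : ℕ)) : (p (inPos l i)).1 = (p (outPos l i)).1 := by
  by_cases hi : (i : ℕ) = 0
  · obtain rfl : i = ⟨0, l.pos⟩ := Fin.ext hi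
    rw [← lastPos_eq_inPos, ← firstPos_eq_outPos, h.closed]
  · exact (h.clause_step _ _ (odd_inPos l i) (by simp [inPos, outPos, hi]; omega)).symm

theorem IsSlotCycle.slotPair {m k : ℕ} {l : ℕ+} {p : Fin (2 * (l : ℕ)) → Fin m × Fin k}
    (h : IsSlotCycle l p) (i : Fin (l : ℕ)) :
    SlotPair i ((p (outPos l i)).2, (p (inPos l i)).2) := by
  unfold SlotPair
  split_ifs with hi
  · obtain rfl : i = ⟨0, l.pos⟩ := Fin.ext hi
    rw [← lastPos_eq_inPos, ← firstPos_eq_outPos]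
    exact h.oriented
  · exact h.slot_step _ _ (odd_inPos l i) (by simp [inPos, outPos, hi]; omega)

/-- A slot cycle is a sequence of distinct clauses with a pair of slots in each of them. -/
def slotCycleEquiv (m k : ℕ) (l : ℕ+) :
    {p : Fin (2 * (l : ℕ)) → Fin m × Fin k // IsSlotCycle l p} ≃
      {f : Fin (l : ℕ) ↪ Fin m // ∀ i, f ⟨0, l.pos⟩ ≤ f i} ×
        {g : Fin (l : ℕ) → Fin k × Fin k // ∀ i, SlotPair i (g i)} where
  toFun p := ⟨⟨⟨fun i => (p.1 (outPos l i)).1, fun i j hij => by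
      have := p.2.clauses_distinct _ _ (even_outPos l i) (even_outPos l j) hij
      rw [← clauseIdx_outPos l i, this, clauseIdx_outPos]⟩, fun i => p.2.start_min _⟩,
    ⟨fun i => ((p.1 (outPos l i)).2, (p.1 (inPos l i)).2), fun i => p.2.slotPair i⟩⟩
  invFun x := ⟨fun t => (x.1.1 (clauseIdx l t),
      if Even (t : ℕ) then (x.2.1 (clauseIdx l t)).1 else (x.2.1 (clauseIdx l t)).2), by
    obtain ⟨⟨f, hf⟩, g, hg⟩ := x
    have h0 := hg ⟨0, l.pos⟩
    have hidx : ∀ t t' : Fin (2 * (l : ℕ)), Odd (t : ℕ) → (t' : ℕ) = t + 1 →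
        clauseIdx l t' = clauseIdx l t := fun t t' ht htt => by
      have := Nat.odd_iff.1 ht
      have := t'.2
      unfold clauseIdx
      rw [dif_neg (by omega), dif_neg (by omega)]
      exact Fin.ext (by simp only; omega)
    refine ⟨?_, fun t => ?_, fun t t' ht ht' he => ?_, fun t t' ht htt => ?_,
      fun t t' ht htt => ?_, ?_⟩
    · simp only [clauseIdx_firstPos, clauseIdx_lastPos]
    · simp only [clauseIdx_firstPos]
      exact hf _
    · have := f.injective he
      rw [← outPos_clauseIdx ht, this, outPos_clauseIdx ht']
    · simp only [hidx t t' ht htt]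
    · have he : Even (t' : ℕ) := by rw [htt]; exact ht.add_one
      -- The only odd position in the initial clause is the last one, which has no successor.
      have hi : (clauseIdx l t : ℕ) ≠ 0 := fun h => by
        have h1 := inPos_clauseIdx ht
        rw [show clauseIdx l t = ⟨0, l.pos⟩ from Fin.ext h, ← lastPos_eq_inPos] at h1
        have h2 := congrArg Fin.val h1
        simp only [lastPos] at h2
        omega
      simp only [if_pos he, if_neg (Nat.not_even_iff_odd.2 ht), hidx t t' ht htt]
      have := hg (clauseIdx l t)
      unfold SlotPair at this
      rwa [if_neg hi] at this
    · unfold SlotPair at h0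
      rw [if_pos rfl] at h0
      simpa only [clauseIdx_firstPos, clauseIdx_lastPos, if_pos (even_firstPos l),
        if_neg (not_even_lastPos l)] using h0⟩
  left_inv p := by
    refine Subtype.ext (funext fun t => ?_)
    rcases Nat.even_or_odd (t : ℕ) with ht | ht
    · refine Prod.ext ?_ ?_
      · exact congrArg (fun t => (p.1 t).1) (outPos_clauseIdx ht)
      · simp only [if_pos ht, outPos_clauseIdx ht]
    · refine Prod.ext ?_ ?_
      · exact (p.2.fst_inPos (clauseIdx l t)).symm.trans
          (congrArg (fun t => (p.1 t).1) (inPos_clauseIdx ht))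
      · simp only [if_neg (Nat.not_even_iff_odd.2 ht), inPos_clauseIdx ht]
  right_inv x := by
    refine Prod.ext (Subtype.ext ?_) (Subtype.ext (funext fun i => ?_))
    · ext i
      simp [clauseIdx_outPos]
    · simp only [clauseIdx_outPos, clauseIdx_inPos, if_pos (even_outPos _ _),
        if_neg (Nat.not_even_iff_odd.2 (odd_inPos _ _))]

/-- In the factor `2l`, the `l` comes from starting at the smallest clause and the `2` from the
orientation. -/
theorem card_isSlotCycle (m k : ℕ) (l : ℕ+) :
    2 * (l : ℕ) * Nat.card {p : Fin (2 * (l : ℕ)) → Fin m × Fin k // IsSlotCycle l p}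
      = m.descFactorial l * (k * (k - 1)) ^ (l : ℕ) := by
  rw [Nat.card_congr (slotCycleEquiv m k l), Nat.card_prod,
    Nat.card_congr (Equiv.subtypePiEquivPi (p := fun i x => SlotPair i x)), Nat.card_pi,
    ← two_mul_prod_card_slotPair, ← card_embedding_min m (⟨0, l.pos⟩ : Fin (l : ℕ))]
  ring

/-- The number of the variable at a position of a cycle. -/
def varIdx (l : ℕ+) (t : Fin (2 * (l : ℕ))) : Fin (l : ℕ) := ⟨(t : ℕ) / 2, by omega⟩

/-- The second position of the `i`-th variable of a cycle. -/
def nextPos (l : ℕ+) (i : Fin (l : ℕ)) : Fin (2 * (l : ℕ)) := ⟨2 * (i : ℕ) + 1, by omega⟩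

theorem varIdx_outPos (l : ℕ+) (i : Fin (l : ℕ)) : varIdx l (outPos l i) = i :=
  Fin.ext (by simp [varIdx, outPos])

theorem varIdx_nextPos (l : ℕ+) (i : Fin (l : ℕ)) : varIdx l (nextPos l i) = i :=
  Fin.ext (by simp only [varIdx, nextPos]; omega)

theorem outPos_varIdx {l : ℕ+} {t : Fin (2 * (l : ℕ))} (ht : Even (t : ℕ)) :
    outPos l (varIdx l t) = t := by
  have := Nat.even_iff.1 ht
  exact Fin.ext (by simp only [outPos, varIdx]; omega)

theorem nextPos_varIdx {l : ℕ+} {t : Fin (2 * (l : ℕ))} (ht : Odd (t : ℕ)) :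
    nextPos l (varIdx l t) = t := by
  have := Nat.odd_iff.1 ht
  exact Fin.ext (by simp only [nextPos, varIdx]; omega)

theorem odd_nextPos (l : ℕ+) (i : Fin (l : ℕ)) : Odd ((nextPos l i : Fin _) : ℕ) :=
  ⟨i, rfl⟩

/-- The condition on the two clones of the `i`-th variable of a cycle. -/
def ClonePair {d : ℕ} (s : SignPattern) (i : Fin (s.1 : ℕ)) (x : Fin d × Fin d) : Prop :=
  s.2 (outPos s.1 i) = s.2 (nextPos s.1 i) → x.1 ≠ x.2

/-- A clone cycle is a sequence of distinct variables with a pair of clones of each of them. -/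
def cloneCycleEquiv (n d : ℕ) (s : SignPattern) :
    {f : Fin (2 * (s.1 : ℕ)) → Fin n × Fin d × ℤˣ // IsCloneCycle s f} ≃
      (Fin (s.1 : ℕ) ↪ Fin n) ×
        {g : Fin (s.1 : ℕ) → Fin d × Fin d // ∀ i, ClonePair s i (g i)} where
  toFun p := ⟨⟨fun i => (p.1 (outPos _ i)).1, fun i j hij => by
      have := p.2.vars_distinct _ _ (even_outPos _ i) (even_outPos _ j) hij
      rw [← varIdx_outPos _ i, this, varIdx_outPos]⟩,
    ⟨fun i => ((p.1 (outPos _ i)).2.1, (p.1 (nextPos _ i)).2.1), fun i hs he =>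
      p.2.clone_step (outPos _ i) (nextPos _ i) (even_outPos _ i) rfl (Prod.ext
        (p.2.var_step (outPos _ i) (nextPos _ i) (even_outPos _ i) rfl)
        (Prod.ext he (by rw [p.2.signs, p.2.signs, hs])))⟩⟩
  invFun x := ⟨fun t => (x.1 (varIdx _ t),
      if Even (t : ℕ) then (x.2.1 (varIdx _ t)).1 else (x.2.1 (varIdx _ t)).2, s.2 t), by
    obtain ⟨f, g, hg⟩ := x
    have hidx : ∀ t t' : Fin (2 * (s.1 : ℕ)), Even (t : ℕ) → (t' : ℕ) = t + 1 →
        varIdx _ t' = varIdx _ t := fun t t' ht htt => by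
      have := Nat.even_iff.1 ht
      exact Fin.ext (by simp only [varIdx]; omega)
    refine ⟨fun t t' ht htt => ?_, fun t t' ht htt he => ?_, fun t t' ht ht' he => ?_,
      fun t => rfl⟩
    · simp only [hidx t t' ht htt]
    · have ho : Odd (t' : ℕ) := by rw [htt]; exact ht.add_one
      simp only [if_pos ht, if_neg (Nat.not_even_iff_odd.2 ho), hidx t t' ht htt, Prod.mk.injEq,
        true_and] at he
      refine hg (varIdx _ t) ?_ he.1
      rw [outPos_varIdx ht, ← hidx t t' ht htt, nextPos_varIdx ho]
      exact he.2
    · have := f.injective he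
      rw [← outPos_varIdx ht, this, outPos_varIdx ht']⟩
  left_inv p := by
    refine Subtype.ext (funext fun t => ?_)
    rcases Nat.even_or_odd (t : ℕ) with ht | ht
    · refine Prod.ext ?_ (Prod.ext ?_ (p.2.signs t).symm)
      · exact congrArg (fun t => (p.1 t).1) (outPos_varIdx ht)
      · simp only [if_pos ht, outPos_varIdx ht]
    · refine Prod.ext ?_ (Prod.ext ?_ (p.2.signs t).symm)
      · have := p.2.var_step (outPos _ (varIdx _ t)) (nextPos _ (varIdx _ t)) (even_outPos _ _) rfl
        exact this.trans (congrArg (fun t => (p.1 t).1) (nextPos_varIdx ht))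
      · simp only [if_neg (Nat.not_even_iff_odd.2 ht), nextPos_varIdx ht]
  right_inv x := by
    refine Prod.ext ?_ (Subtype.ext (funext fun i => ?_))
    · ext i
      simp [varIdx_outPos]
    · simp only [varIdx_outPos, varIdx_nextPos, if_pos (even_outPos _ _),
        if_neg (Nat.not_even_iff_odd.2 (odd_nextPos _ _))]

/-- The signs are prescribed, so only the indices in `Fin d` are free; they must differ exactly when
the two signs agree. -/
theorem card_isCloneCycle (n d : ℕ) (s : SignPattern) :
    Nat.card {f : Fin (2 * (s.1 : ℕ)) → Fin n × Fin d × ℤˣ // IsCloneCycle s f}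
      = n.descFactorial (s.1 : ℕ) * ∏ i : Fin (s.1 : ℕ),
        (if s.2 (outPos s.1 i) = s.2 (nextPos s.1 i) then d * (d - 1) else d * d) := by
  rw [Nat.card_congr (cloneCycleEquiv n d s), Nat.card_prod,
    Nat.card_congr (Equiv.subtypePiEquivPi (p := fun i x => ClonePair s i x)), Nat.card_pi,
    Nat.card_eq_fintype_card (α := _ ↪ _), Fintype.card_embedding_eq, Fintype.card_fin,
    Fintype.card_fin]
  congr 1
  refine Finset.prod_congr rfl fun i _ => ?_
  split_ifs with h
  · rw [← card_ne_pairs]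
    exact Nat.card_congr (Equiv.subtypeEquivRight fun x => by simp [ClonePair, h])
  · rw [Nat.card_congr (Equiv.subtypeUnivEquiv (p := fun x : Fin d × Fin d => ClonePair s i x)
      fun x => fun hs => absurd hs h)]
    simp

/-! ### Families: exact counts and sums over all formulas. -/

section Families

variable {T : Type*} [Fintype T] (σ : T → SignPattern)

theorem card_isSlotFamily (m k : ℕ) :
    Nat.card {q : Pos σ → Fin m × Fin k // IsSlotFamily σ q} = ∏ τ,
      Nat.card {p : Fin (2 * ((σ τ).1 : ℕ)) → Fin m × Fin k // IsSlotCycle (σ τ).1 p} := by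
  rw [← Nat.card_pi]
  exact Nat.card_congr (((Equiv.piCurry fun _ _ => Fin m × Fin k).subtypeEquiv
    fun _ => Iff.rfl).trans Equiv.subtypePiEquivPi)

theorem card_isCloneFamily (n d : ℕ) :
    Nat.card {q : Pos σ → Fin n × Fin d × ℤˣ // IsCloneFamily σ q} = ∏ τ,
      Nat.card {f : Fin (2 * ((σ τ).1 : ℕ)) → Fin n × Fin d × ℤˣ // IsCloneCycle (σ τ) f} := by
  rw [← Nat.card_pi]
  exact Nat.card_congr (((Equiv.piCurry fun _ _ => Fin n × Fin d × ℤˣ).subtypeEquiv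
    fun _ => Iff.rfl).trans Equiv.subtypePiEquivPi)

end Families

/-- Pairs `(Φ, q)` are classified by the assignment `f = Φ ∘ q`, which reduces the sum over formulas
to counting extensions of assignments. -/
theorem sum_card_filter_comp {I X Y : Type*} [Fintype I] [Fintype X] [Fintype Y] [DecidableEq I]
    [DecidableEq X] [DecidableEq Y] (P : (I → X) → Prop) (R : (I → Y) → Prop) [DecidablePred P]
    [DecidablePred R] [∀ Φ : X ≃ Y, DecidablePred fun q : I → X => P q ∧ R (Φ ∘ q)] :
    ∑ Φ : X ≃ Y, (Finset.univ.filter fun q : I → X => P q ∧ R (Φ ∘ q)).card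
      = ∑ q ∈ Finset.univ.filter P, ∑ f ∈ Finset.univ.filter R,
          (Finset.univ.filter fun Φ : X ≃ Y => ⇑Φ ∘ q = f).card := by
  have h1 : ∀ q : I → X, ∑ f ∈ Finset.univ.filter R,
      (Finset.univ.filter fun Φ : X ≃ Y => ⇑Φ ∘ q = f).card
      = (Finset.univ.filter fun Φ : X ≃ Y => R (Φ ∘ q)).card := fun q => by
    rw [Finset.card_eq_sum_card_fiberwise (f := fun Φ : X ≃ Y => ⇑Φ ∘ q)
      (t := Finset.univ.filter R) fun Φ hΦ => by simpa using hΦ]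
    refine Finset.sum_congr rfl fun f hf => ?_
    congr 1
    ext Φ
    simp only [Finset.mem_filter, Finset.mem_univ, true_and] at *
    exact ⟨fun h => ⟨by rwa [h], h⟩, fun h => h.2⟩
  simp_rw [h1, Finset.card_filter]
  rw [Finset.sum_comm, Finset.sum_filter]
  refine Finset.sum_congr rfl fun q _ => ?_
  split_ifs with h <;> simp [h]

section Families

variable {T : Type*} [Fintype T] (σ : T → SignPattern)

/-- The number of families of distinct cycles with given sign patterns. -/
def familyCount {m k n d : ℕ} (Φ : Formula m k n d) : ℕ :=
  Nat.card {q : Pos σ → Fin m × Fin k // IsCycleFamily σ Φ q}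

/-- The number of families of clause-disjoint slot cycles. -/
def disjointSlotCount (m k : ℕ) : ℕ :=
  Nat.card {q : Pos σ → Fin m × Fin k // IsSlotFamily σ q ∧ fstCard q = totalLen σ}

/-- The number of families of variable-disjoint clone cycles. -/
def disjointCloneCount (n d : ℕ) : ℕ :=
  Nat.card {f : Pos σ → Fin n × Fin d × ℤˣ // IsCloneFamily σ f ∧ fstCard f = totalLen σ}

variable {m k n d : ℕ}

/-- The number of families of vertex-disjoint cycles. -/
def disjointFamilyCount (Φ : Formula m k n d) : ℕ :=
  Nat.card {q : Pos σ → Fin m × Fin k // (IsSlotFamily σ q ∧ fstCard q = totalLen σ) ∧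
    (IsCloneFamily σ (Φ ∘ q) ∧ fstCard (Φ ∘ q) = totalLen σ)}

/-- Disjointness makes both `q` and `f` injective, so every pair `(q, f)` is extended by the same
number of formulas. -/
theorem sum_disjointFamilyCount (h : m * k = n * (d * 2)) :
    ∑ Φ : Formula m k n d, disjointFamilyCount σ Φ
      = disjointSlotCount σ m k * disjointCloneCount σ n d
        * (m * k - 2 * totalLen σ).factorial := by
  classical
  simp only [disjointFamilyCount, disjointSlotCount, disjointCloneCount, Nat.card_eq_fintype_card,
    Fintype.card_subtype]
  rw [sum_card_filter_comp (fun q : Pos σ → Fin m × Fin k => IsSlotFamily σ q ∧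
      fstCard q = totalLen σ) (fun f : Pos σ → Fin n × Fin d × ℤˣ => IsCloneFamily σ f ∧
      fstCard f = totalLen σ)]
  have hc : ∀ q ∈ Finset.univ.filter fun q : Pos σ → Fin m × Fin k => IsSlotFamily σ q ∧
      fstCard q = totalLen σ, ∀ f ∈ Finset.univ.filter fun f : Pos σ → Fin n × Fin d × ℤˣ =>
      IsCloneFamily σ f ∧ fstCard f = totalLen σ,
      (Finset.univ.filter fun Φ : Formula m k n d => ⇑Φ ∘ q = f).card
        = (m * k - 2 * totalLen σ).factorial := by
    intro q hq f hf
    obtain ⟨hq1, hq2⟩ := (Finset.mem_filter.1 hq).2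
    obtain ⟨hf1, hf2⟩ := (Finset.mem_filter.1 hf).2
    obtain ⟨Φ₀, h0⟩ := exists_equiv_extending (by simpa using h) (hq1.injective hq2)
      (hf1.injective hf2)
    rw [card_equiv_extending (hq1.injective hq2) Φ₀ h0, card_pos]
    simp
  rw [Finset.sum_congr rfl fun q hq => Finset.sum_congr rfl fun f hf => hc q hq f hf]
  simp [mul_assoc]

/-- The triples of possible numbers of clauses, variables and edges of the union of a family of
distinct cycles that are not disjoint. -/
def denseTriples : Finset (ℕ × ℕ × ℕ) :=
  (Finset.range (2 * totalLen σ + 1) ×ˢ Finset.range (2 * totalLen σ + 1) ×ˢ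
    Finset.range (2 * totalLen σ + 1)).filter fun x => x.1 + x.2.1 < x.2.2

/-- The number of position families with given numbers of clauses, variables and edges. -/
def unionCount (Φ : Formula m k n d) (x : ℕ × ℕ × ℕ) : ℕ :=
  Nat.card {q : Pos σ → Fin m × Fin k // (fstCard q = x.1 ∧ imageCard q = x.2.2) ∧
    fstCard (Φ ∘ q) = x.2.1}

theorem disjointFamilyCount_le (Φ : Formula m k n d) :
    disjointFamilyCount σ Φ ≤ familyCount σ Φ := by
  classical
  simp only [disjointFamilyCount, familyCount, Nat.card_eq_fintype_card, Fintype.card_subtype]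
  refine Finset.card_le_card fun q => ?_
  simp only [Finset.mem_filter, Finset.mem_univ, true_and]
  rintro ⟨⟨h1, h2⟩, h3, -⟩
  exact isCycleFamily_of_injective h1 h3 (h1.injective h2)

/-- For overlapping families the cycle conditions are discarded and only the dense shape of the
union is kept; its order of magnitude suffices. -/
theorem familyCount_le (Φ : Formula m k n d) :
    familyCount σ Φ ≤ disjointFamilyCount σ Φ + ∑ x ∈ denseTriples σ, unionCount σ Φ x := by
  classical
  simp only [disjointFamilyCount, familyCount, unionCount, Nat.card_eq_fintype_card,
    Fintype.card_subtype]
  refine le_trans ?_ (Nat.add_le_add_left Finset.card_biUnion_le _)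
  refine le_trans (Finset.card_le_card fun q => ?_) (Finset.card_union_le _ _)
  simp only [Finset.mem_filter, Finset.mem_univ, true_and, Finset.mem_union, Finset.mem_biUnion]
  intro hq
  obtain ⟨hs, hf⟩ := (forall_isCycle_iff Φ q).1 hq.1
  rcases hq.disjoint_or_lt with h | h
  · exact Or.inl ⟨⟨hs, h.1⟩, hf, h.2⟩
  · have := imageCard_le q
    rw [card_pos] at this
    refine Or.inr ⟨(fstCard q, fstCard (Φ ∘ q), imageCard q), ?_, by simp⟩
    simp only [denseTriples, Finset.mem_filter, Finset.mem_product, Finset.mem_range]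
    omega

/-- After division by `(m * k)!` this is of order `n^(a + v - e)`; the remaining factors do not
depend on `n`. -/
theorem sum_unionCount_le (a v e : ℕ) :
    ∑ Φ : Formula m k n d, unionCount σ Φ (a, v, e)
      ≤ (a ^ (2 * totalLen σ) * k ^ (2 * totalLen σ) * m ^ a)
        * (v ^ (2 * totalLen σ) * (d * 2) ^ (2 * totalLen σ) * n ^ v)
        * (m * k - e).factorial := by
  classical
  simp only [unionCount, Nat.card_eq_fintype_card, Fintype.card_subtype]
  rw [sum_card_filter_comp (fun q : Pos σ → Fin m × Fin k => fstCard q = a ∧ imageCard q = e)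
    (fun f : Pos σ → Fin n × Fin d × ℤˣ => fstCard f = v)]
  refine (Finset.sum_le_sum fun q hq => Finset.sum_le_sum fun f _ =>
    (card_equiv_extending_le q f).trans_eq (by rw [(Finset.mem_filter.1 hq).2.2])).trans ?_
  simp only [Finset.sum_const, smul_eq_mul, ← mul_assoc]
  have h1 : (Finset.univ.filter fun q : Pos σ → Fin m × Fin k =>
      fstCard q = a ∧ imageCard q = e).card
      ≤ a ^ (2 * totalLen σ) * k ^ (2 * totalLen σ) * m ^ a := by
    refine (Finset.card_le_card fun q => ?_).trans ((card_fstCard_eq_le a).trans_eq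
      (by rw [card_pos, Fintype.card_fin, Fintype.card_fin]))
    simp only [Finset.mem_filter, Finset.mem_univ, true_and]
    exact fun h => h.1
  have h2 : (Finset.univ.filter fun f : Pos σ → Fin n × Fin d × ℤˣ => fstCard f = v).card
      ≤ v ^ (2 * totalLen σ) * (d * 2) ^ (2 * totalLen σ) * n ^ v :=
    (card_fstCard_eq_le v).trans_eq (by rw [card_pos]; simp)
  have h3 : Fintype.card (Fin m × Fin k) = m * k := by simp
  rw [h3]
  calc _ ≤ (a ^ (2 * totalLen σ) * k ^ (2 * totalLen σ) * m ^ a)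
        * (v ^ (2 * totalLen σ) * (d * 2) ^ (2 * totalLen σ) * n ^ v)
        * (m * k - e).factorial := by gcongr
    _ = _ := by simp only [← mul_assoc]

end Families

/-! ### Asymptotics of the counts and of the factorial moments. -/

section Asymptotics

variable {F : Filter ℕ} {u : ℕ → ℕ} {c : ℝ}

theorem tendsto_natCast_pow_div_pow (hF : F ≤ atTop) {a b : ℕ} (h : a < b) :
    Tendsto (fun n : ℕ => (n : ℝ) ^ a / (n : ℝ) ^ b) F (𝓝 0) :=
  ((tendsto_pow_div_pow_atTop_zero h).comp tendsto_natCast_atTop_atTop).mono_left hF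

theorem tendsto_pow_div_pow_zero (hF : F ≤ atTop) (hu : Tendsto (fun n => (u n : ℝ) / n) F (𝓝 c))
    {a b e : ℕ} (h : a + b < e) :
    Tendsto (fun n => (u n : ℝ) ^ a * (n : ℝ) ^ b / (n : ℝ) ^ e) F (𝓝 0) := by
  have h1 := (hu.pow a).mul (tendsto_natCast_pow_div_pow hF h)
  rw [mul_zero] at h1
  refine h1.congr' ?_
  filter_upwards [hF (eventually_ne_atTop 0)] with n hn
  have : (n : ℝ) ≠ 0 := by exact_mod_cast hn
  rw [div_pow, pow_add]
  field_simp

theorem tendsto_descFactorial_div_pow (hF : F ≤ atTop)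
    (hu : Tendsto (fun n => (u n : ℝ) / n) F (𝓝 c)) (r : ℕ) :
    Tendsto (fun n => ((u n).descFactorial r : ℝ) / (n : ℝ) ^ r) F (𝓝 (c ^ r)) := by
  induction r with
  | zero => simp [tendsto_const_nhds]
  | succ r ih =>
    have h0 : Tendsto (fun n : ℕ => (r : ℝ) / n) F (𝓝 0) :=
      (tendsto_const_div_atTop_nhds_zero_nat (r : ℝ)).mono_left hF
    have h1 := hu.sub h0
    rw [sub_zero] at h1
    -- The subtraction is truncated, hence the squeeze between the real difference and `u n`.
    have h2 : Tendsto (fun n => ((u n - r : ℕ) : ℝ) / n) F (𝓝 c) := by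
      refine tendsto_of_tendsto_of_tendsto_of_le_of_le h1 hu (fun n => ?_) fun n => ?_
      · simp only [← sub_div]
        gcongr
        rw [sub_le_iff_le_add]
        exact_mod_cast (by omega : u n ≤ u n - r + r)
      · simp only
        gcongr
        exact Nat.sub_le _ _
    have h3 := h2.mul ih
    rw [← pow_succ'] at h3
    refine h3.congr fun n => ?_
    rw [Nat.descFactorial_succ, Nat.cast_mul, pow_succ', div_mul_div_comm]

/-- Maps with fewer than `L` distinct first components number only `O(n^(L-1))`, so demanding
disjointness does not change the leading order. -/
theorem tendsto_card_fstCard_eq {I β : Type*} [Fintype I] [Fintype β] (hF : F ≤ atTop)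
    (hu : Tendsto (fun n => (u n : ℝ) / n) F (𝓝 c)) {L : ℕ} {x : ℝ}
    (P : ∀ n, (I → Fin (u n) × β) → Prop) (hP : ∀ n f, P n f → fstCard f ≤ L)
    (h : Tendsto (fun n => (Nat.card {f // P n f} : ℝ) / (n : ℝ) ^ L) F (𝓝 x)) :
    Tendsto (fun n => (Nat.card {f // P n f ∧ fstCard f = L} : ℝ) / (n : ℝ) ^ L) F (𝓝 x) := by
  classical
  let C : ℕ → ℝ := fun a => (a : ℝ) ^ Fintype.card I * (Fintype.card β : ℝ) ^ Fintype.card I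
  have h0 : Tendsto (fun n => ∑ a ∈ Finset.range L,
      C a * ((u n : ℝ) ^ a * (n : ℝ) ^ 0 / (n : ℝ) ^ L)) F (𝓝 0) := by
    have := tendsto_finsetSum (Finset.range L) fun a ha =>
      (tendsto_pow_div_pow_zero (b := 0) hF hu (Finset.mem_range.1 ha)).const_mul (C a)
    simpa only [mul_zero, Finset.sum_const_zero] using this
  have h1 := h.sub h0
  rw [sub_zero] at h1
  refine tendsto_of_tendsto_of_tendsto_of_le_of_le h1 h (fun n => ?_) fun n => ?_
  · have hle : Nat.card {f // P n f} ≤ Nat.card {f // P n f ∧ fstCard f = L}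
        + ∑ a ∈ Finset.range L, a ^ Fintype.card I * Fintype.card β ^ Fintype.card I * u n ^ a := by
      simp only [Nat.card_eq_fintype_card, Fintype.card_subtype]
      refine le_trans (Finset.card_le_card fun f => ?_) ((Finset.card_union_le _
        ((Finset.range L).biUnion fun a => Finset.univ.filter fun f : I → Fin (u n) × β =>
          fstCard f = a)).trans (Nat.add_le_add_left (Finset.card_biUnion_le.trans
            (Finset.sum_le_sum fun a _ => (card_fstCard_eq_le a).trans_eq (by simp))) _))
      simp only [Finset.mem_filter, Finset.mem_univ, true_and, Finset.mem_union,
        Finset.mem_biUnion, Finset.mem_range]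
      intro hf
      rcases (hP n f hf).lt_or_eq with h | h
      · exact Or.inr ⟨_, h, rfl⟩
      · exact Or.inl ⟨hf, h⟩
    have hle' : (Nat.card {f // P n f} : ℝ) ≤ Nat.card {f // P n f ∧ fstCard f = L}
        + ∑ a ∈ Finset.range L, C a * (u n : ℝ) ^ a := by
      simp only [C]
      exact_mod_cast hle
    simp only [pow_zero, mul_one, mul_div_assoc', ← Finset.sum_div, ← sub_div]
    gcongr
    linarith
  · simp only
    gcongr
    simp only [Nat.card_eq_fintype_card, Fintype.card_subtype]
    refine Finset.card_le_card fun f => ?_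
    simp only [Finset.mem_filter, Finset.mem_univ, true_and]
    exact fun h => h.1

theorem tendsto_card_isSlotCycle (hF : F ≤ atTop)
    (hu : Tendsto (fun n => (u n : ℝ) / n) F (𝓝 c)) (k : ℕ) (l : ℕ+) :
    Tendsto (fun n => (Nat.card {p : Fin (2 * (l : ℕ)) → Fin (u n) × Fin k // IsSlotCycle l p} : ℝ)
      / (n : ℝ) ^ (l : ℕ)) F
      (𝓝 (c ^ (l : ℕ) * ((k : ℝ) * ((k - 1 : ℕ) : ℝ)) ^ (l : ℕ) / (2 * ((l : ℕ) : ℝ)))) := by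
  have h1 := ((tendsto_descFactorial_div_pow hF hu (l : ℕ)).mul_const
    (((k : ℝ) * ((k - 1 : ℕ) : ℝ)) ^ (l : ℕ))).div_const (2 * ((l : ℕ) : ℝ))
  refine h1.congr fun n => ?_
  have h2 : (2 * ((l : ℕ) : ℝ)) * (Nat.card {p : Fin (2 * (l : ℕ)) → Fin (u n) × Fin k //
      IsSlotCycle l p} : ℝ) = ((u n).descFactorial l : ℝ) *
        ((k : ℝ) * ((k - 1 : ℕ) : ℝ)) ^ (l : ℕ) := by
    exact_mod_cast card_isSlotCycle (u n) k l
  have h3 : (2 * ((l : ℕ) : ℝ)) ≠ 0 := by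
    have : ((l : ℕ) : ℝ) ≠ 0 := by exact_mod_cast l.pos.ne'
    positivity
  rw [div_mul_eq_mul_div, ← h2, div_div, mul_comm ((n : ℝ) ^ (l : ℕ)), ← div_div,
    mul_div_cancel_left₀ _ h3]

/-- The number of choices of the clones of the variables of a cycle. -/
def cloneWeight (d : ℕ) (s : SignPattern) : ℕ :=
  ∏ i : Fin (s.1 : ℕ), if s.2 (outPos s.1 i) = s.2 (nextPos s.1 i) then d * (d - 1) else d * d

theorem tendsto_card_isCloneCycle (hF : F ≤ atTop) (d : ℕ) (s : SignPattern) :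
    Tendsto (fun n : ℕ => (Nat.card {f : Fin (2 * (s.1 : ℕ)) → Fin n × Fin d × ℤˣ //
      IsCloneCycle s f} : ℝ) / (n : ℝ) ^ (s.1 : ℕ)) F (𝓝 (cloneWeight d s)) := by
  have hu : Tendsto (fun n : ℕ => (n : ℝ) / n) F (𝓝 1) := by
    refine tendsto_const_nhds.congr' ?_
    filter_upwards [hF (eventually_ne_atTop 0)] with n hn
    rw [div_self (by exact_mod_cast hn)]
  have h1 := (tendsto_descFactorial_div_pow hF hu (s.1 : ℕ)).mul_const (cloneWeight d s : ℝ)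
  rw [one_pow, one_mul] at h1
  refine h1.congr fun n => ?_
  rw [card_isCloneCycle, Nat.cast_mul, div_mul_eq_mul_div]
  rfl

section Families

variable {T : Type*} [Fintype T] (σ : T → SignPattern)

theorem prod_pow_len (x : ℝ) : ∏ τ, x ^ ((σ τ).1 : ℕ) = x ^ totalLen σ :=
  Finset.prod_pow_eq_pow_sum _ _ _

theorem tendsto_disjointSlotCount (hF : F ≤ atTop)
    (hu : Tendsto (fun n => (u n : ℝ) / n) F (𝓝 c)) (k : ℕ) :
    Tendsto (fun n => (disjointSlotCount σ (u n) k : ℝ) / (n : ℝ) ^ totalLen σ) F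
      (𝓝 (∏ τ, (c ^ ((σ τ).1 : ℕ) * ((k : ℝ) * ((k - 1 : ℕ) : ℝ)) ^ ((σ τ).1 : ℕ)
        / (2 * (((σ τ).1 : ℕ) : ℝ))))) := by
  refine tendsto_card_fstCard_eq hF hu (fun n q => IsSlotFamily σ q) (fun n q h => h.fstCard_le) ?_
  refine (tendsto_finsetProd Finset.univ fun τ _ =>
    tendsto_card_isSlotCycle hF hu k (σ τ).1).congr fun n => ?_
  rw [Finset.prod_div_distrib, prod_pow_len, card_isSlotFamily, Nat.cast_prod]

theorem tendsto_disjointCloneCount (hF : F ≤ atTop) (d : ℕ) :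
    Tendsto (fun n => (disjointCloneCount σ n d : ℝ) / (n : ℝ) ^ totalLen σ) F
      (𝓝 (∏ τ, (cloneWeight d (σ τ) : ℝ))) := by
  have hu : Tendsto (fun n : ℕ => (n : ℝ) / n) F (𝓝 1) := by
    refine tendsto_const_nhds.congr' ?_
    filter_upwards [hF (eventually_ne_atTop 0)] with n hn
    rw [div_self (by exact_mod_cast hn)]
  refine tendsto_card_fstCard_eq (u := fun n => n) hF hu (fun n q => IsCloneFamily σ q)
    (fun n q h => h.fstCard_le) ?_
  refine (tendsto_finsetProd Finset.univ fun τ _ =>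
    tendsto_card_isCloneCycle hF d (σ τ)).congr fun n => ?_
  rw [Finset.prod_div_distrib, prod_pow_len, card_isCloneFamily, Nat.cast_prod]

variable {m : ℕ → ℕ} {k d : ℕ}

theorem mean_natCast_eq {m k n d : ℕ} (h : m * k = n * (d * 2)) (f : Formula m k n d → ℕ) :
    mean (fun Φ => (f Φ : ℝ)) = ((∑ Φ, f Φ : ℕ) : ℝ) / (m * k).factorial := by
  have e : (Fin m × Fin k) ≃ (Fin n × Fin d × ℤˣ) :=
    Fintype.equivOfCardEq (by simpa using h)
  rw [mean, Fintype.card_equiv e]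
  simp

/-- This isolates the power `n^(-e)`; the remaining denominator has a nonzero limit when `N` is of
order `n`. -/
theorem factorial_sub_div_factorial {N e n : ℕ} (h : e ≤ N) (hn : n ≠ 0) :
    ((N - e).factorial : ℝ) / N.factorial
      = 1 / (n : ℝ) ^ e / ((N.descFactorial e : ℝ) / (n : ℝ) ^ e) := by
  have h1 : ((N - e).factorial : ℝ) * N.descFactorial e = N.factorial := by
    exact_mod_cast Nat.factorial_mul_descFactorial h
  have h2 : ((N - e).factorial : ℝ) ≠ 0 := by exact_mod_cast Nat.factorial_ne_zero _
  have h3 : (N.descFactorial e : ℝ) ≠ 0 := by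
    exact_mod_cast (Nat.descFactorial_eq_zero_iff_lt.not.2 (by omega))
  have h4 : (n : ℝ) ≠ 0 := by exact_mod_cast hn
  rw [← h1]
  field_simp

theorem tendsto_clauses_div (hF : F ≤ atTop) (hk : k ≠ 0)
    (hm : ∀ᶠ n in F, m n * k = n * (d * 2)) :
    Tendsto (fun n => (m n : ℝ) / n) F (𝓝 (2 * d / k)) := by
  refine tendsto_const_nhds.congr' ?_
  filter_upwards [hm, hF (eventually_ne_atTop 0)] with n h hn
  have h1 : (m n : ℝ) * k = n * (d * 2) := by exact_mod_cast h
  have h2 : (n : ℝ) ≠ 0 := by exact_mod_cast hn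
  have h3 : (k : ℝ) ≠ 0 := by exact_mod_cast hk
  rw [div_eq_div_iff h3 h2]
  linarith

theorem tendsto_slots_div (hF : F ≤ atTop) (hm : ∀ᶠ n in F, m n * k = n * (d * 2)) :
    Tendsto (fun n => ((m n * k : ℕ) : ℝ) / n) F (𝓝 (2 * d)) := by
  refine tendsto_const_nhds.congr' ?_
  filter_upwards [hm, hF (eventually_ne_atTop 0)] with n h hn
  have h2 : (n : ℝ) ≠ 0 := by exact_mod_cast hn
  rw [h, eq_div_iff h2]
  push_cast
  ring

theorem eventually_le_slots (hF : F ≤ atTop) (hd : d ≠ 0)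
    (hm : ∀ᶠ n in F, m n * k = n * (d * 2)) (e : ℕ) : ∀ᶠ n in F, e ≤ m n * k := by
  filter_upwards [hm, hF (eventually_ge_atTop e)] with n h hn
  rw [h]
  exact hn.trans (Nat.le_mul_of_pos_right _ (by omega))

/-- The factorial moment contribution of a family of cycles. -/
theorem tendsto_mean_disjointFamilyCount (hF : F ≤ atTop) (hk : k ≠ 0) (hd : d ≠ 0)
    (hm : ∀ᶠ n in F, m n * k = n * (d * 2)) :
    Tendsto (fun n => mean fun Φ : Formula (m n) k n d => (disjointFamilyCount σ Φ : ℝ)) F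
      (𝓝 (∏ τ, ((2 * d / k : ℝ) ^ ((σ τ).1 : ℕ) *
        ((k : ℝ) * ((k - 1 : ℕ) : ℝ)) ^ ((σ τ).1 : ℕ) / (2 * (((σ τ).1 : ℕ) : ℝ))
        * cloneWeight d (σ τ) / ((2 * d : ℝ) ^ 2) ^ ((σ τ).1 : ℕ)))) := by
  have h1 := (tendsto_disjointSlotCount σ hF (tendsto_clauses_div hF hk hm) k).mul
    (tendsto_disjointCloneCount σ hF d)
  have h2 := tendsto_descFactorial_div_pow hF (tendsto_slots_div hF hm) (2 * totalLen σ)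
  have h3 := h1.div h2 (by positivity)
  rw [pow_mul, ← prod_pow_len, ← Finset.prod_mul_distrib, ← Finset.prod_div_distrib] at h3
  refine h3.congr' ?_
  filter_upwards [hm, hF (eventually_ne_atTop 0), eventually_le_slots hF hd hm (2 * totalLen σ)]
    with n h hn he
  have h4 : (n : ℝ) ≠ 0 := by exact_mod_cast hn
  rw [mean_natCast_eq h, sum_disjointFamilyCount σ h, Nat.cast_mul, mul_div_assoc,
    factorial_sub_div_factorial he hn, Nat.cast_mul]
  simp only [Pi.div_apply]
  -- One factor `n ^ totalLen σ` cancels the clause normalisation and the other the variable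
  -- normalisation.
  rw [two_mul (totalLen σ), pow_add]
  field_simp

theorem tendsto_mean_unionCount (hF : F ≤ atTop) (hk : k ≠ 0) (hd : d ≠ 0)
    (hm : ∀ᶠ n in F, m n * k = n * (d * 2)) {a v e : ℕ} (hlt : a + v < e) :
    Tendsto (fun n => mean fun Φ : Formula (m n) k n d => (unionCount σ Φ (a, v, e) : ℝ)) F
      (𝓝 0) := by
  let A : ℝ := (a : ℝ) ^ (2 * totalLen σ) * (k : ℝ) ^ (2 * totalLen σ)
  let V : ℝ := (v : ℝ) ^ (2 * totalLen σ) * ((d : ℝ) * 2) ^ (2 * totalLen σ)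
  have h1 := ((tendsto_pow_div_pow_zero hF (tendsto_clauses_div hF hk hm) hlt).const_mul
    (A * V)).div (tendsto_descFactorial_div_pow hF (tendsto_slots_div hF hm) e) (by positivity)
  rw [mul_zero, zero_div] at h1
  refine squeeze_zero' (Eventually.of_forall fun n => ?_) ?_ h1
  · unfold mean
    positivity
  · filter_upwards [hm, hF (eventually_ne_atTop 0), eventually_le_slots hF hd hm e]
      with n h hn he
    rw [mean_natCast_eq h]
    have h2 : ((∑ Φ : Formula (m n) k n d, unionCount σ Φ (a, v, e) : ℕ) : ℝ)
        ≤ (A * (m n : ℝ) ^ a) * (V * (n : ℝ) ^ v) * ((m n * k - e).factorial : ℝ) := by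
      simp only [A, V]
      exact_mod_cast sum_unionCount_le (m := m n) (k := k) (n := n) (d := d) σ a v e
    calc _ ≤ (A * (m n : ℝ) ^ a) * (V * (n : ℝ) ^ v) * ((m n * k - e).factorial : ℝ)
          / (m n * k).factorial := by gcongr
      _ = _ := by
        rw [mul_div_assoc, factorial_sub_div_factorial he hn]
        simp only [Pi.div_apply]
        ring

/-- The joint factorial moments of the cycle counts. -/
theorem tendsto_mean_familyCount (hF : F ≤ atTop) (hk : k ≠ 0) (hd : d ≠ 0)
    (hm : ∀ᶠ n in F, m n * k = n * (d * 2)) :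
    Tendsto (fun n => mean fun Φ : Formula (m n) k n d => (familyCount σ Φ : ℝ)) F
      (𝓝 (∏ τ, ((2 * d / k : ℝ) ^ ((σ τ).1 : ℕ) *
        ((k : ℝ) * ((k - 1 : ℕ) : ℝ)) ^ ((σ τ).1 : ℕ) / (2 * (((σ τ).1 : ℕ) : ℝ))
        * cloneWeight d (σ τ) / ((2 * d : ℝ) ^ 2) ^ ((σ τ).1 : ℕ)))) := by
  have h1 := tendsto_mean_disjointFamilyCount σ hF hk hd hm
  have h2 : Tendsto (fun n => ∑ x ∈ denseTriples σ,
      mean fun Φ : Formula (m n) k n d => (unionCount σ Φ x : ℝ)) F (𝓝 0) := by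
    have := tendsto_finsetSum (denseTriples σ) fun x hx =>
      tendsto_mean_unionCount σ hF hk hd hm (a := x.1) (v := x.2.1) (e := x.2.2)
        (Finset.mem_filter.1 hx).2
    simpa using this
  have h3 := h1.add h2
  rw [add_zero] at h3
  refine tendsto_of_tendsto_of_tendsto_of_le_of_le h1 h3 (fun n => mean_mono fun Φ => ?_)
    fun n => ?_
  · exact_mod_cast disjointFamilyCount_le σ Φ
  · simp only
    rw [← mean_sum, ← sub_le_iff_le_add', ← mean_sub]
    refine mean_mono fun Φ => ?_
    rw [sub_le_iff_le_add']
    exact_mod_cast familyCount_le σ Φ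

end Families

end Asymptotics

/-! ### Identification of the factorial moments and of their limits. -/

/-- The ordered families of distinct cycles of prescribed types. -/
def cycleFamilyEquiv {m k n d : ℕ} (Φ : Formula m k n d) (S : Finset SignPattern) (r : S → ℕ) :
    {q : Pos (fun τ : Σ s : S, Fin (r s) => (τ.1 : SignPattern)) → Fin m × Fin k //
      IsCycleFamily (fun τ : Σ s : S, Fin (r s) => (τ.1 : SignPattern)) Φ q} ≃
    ((s : S) → Fin (r s) ↪
      {p : Fin (2 * (s.1.1 : ℕ)) → Fin m × Fin k // IsCycle Φ s.1 p}) where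
  toFun q s := ⟨fun i => ⟨fun t => q.1 ⟨⟨s, i⟩, t⟩, q.2.1 ⟨s, i⟩⟩, fun i j h => by
    have h1 : (⟨s, i⟩ : Σ s : S, Fin (r s)) = ⟨s, j⟩ :=
      q.2.2 (Sigma.ext rfl (heq_of_eq (congrArg Subtype.val h)))
    exact eq_of_heq (Sigma.mk.inj h1).2⟩
  invFun g := ⟨fun x => (g x.1.1 x.1.2).1 x.2, fun τ => (g τ.1 τ.2).2, by
    rintro ⟨s, i⟩ ⟨s', j⟩ h
    obtain rfl : s = s' := Subtype.ext (congrArg Sigma.fst h)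
    have h1 := eq_of_heq (Sigma.mk.inj h).2
    obtain rfl : i = j := (g s).injective (Subtype.ext h1)
    rfl⟩
  left_inv _ := rfl
  right_inv _ := rfl

/-- A falling factorial counts injections from `Fin (r s)` into the cycles of pattern `s`; cycles of
different patterns are distinct automatically. -/
theorem prod_descFactorial_cycleCount {m k n d : ℕ} (Φ : Formula m k n d)
    (S : Finset SignPattern) (r : S → ℕ) :
    ∏ s : S, (cycleCount s.1 Φ).descFactorial (r s)
      = familyCount (fun τ : Σ s : S, Fin (r s) => (τ.1 : SignPattern)) Φ := by
  classical
  rw [familyCount, Nat.card_congr (cycleFamilyEquiv Φ S r), Nat.card_pi]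
  refine Finset.prod_congr rfl fun s _ => ?_
  rw [Nat.card_eq_fintype_card, Fintype.card_embedding_eq, Fintype.card_fin, cycleCount,
    Nat.card_eq_fintype_card]

theorem units_mul_eq_ite (a b : ℤˣ) : (a : ℤ) * (b : ℤ) = if a = b then 1 else -1 := by
  rcases Int.units_eq_one_or a with rfl | rfl <;> rcases Int.units_eq_one_or b with rfl | rfl <;>
    simp

theorem corr_eq_sum_ite (s : SignPattern) :
    s.corr = ∑ i : Fin (s.1 : ℕ),
      if s.2 (outPos s.1 i) = s.2 (nextPos s.1 i) then (1 : ℤ) else -1 :=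
  Finset.sum_congr rfl fun _ _ => units_mul_eq_ite _ _

/-- A variable with two equal signs would need two different clones of one literal, so one such
variable kills the product; otherwise all sign products are `-1`. -/
theorem cloneWeight_one (s : SignPattern) :
    (cloneWeight 1 s : ℝ) = if s.corr = -((s.1 : ℕ) : ℤ) then 1 else 0 := by
  rw [corr_eq_sum_ite, cloneWeight]
  by_cases h : ∃ i, s.2 (outPos s.1 i) = s.2 (nextPos s.1 i)
  · obtain ⟨i, hi⟩ := h
    rw [Finset.prod_eq_zero (Finset.mem_univ i) (by simp [hi]), if_neg]
    · simp
    · refine ne_of_gt ?_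
      have h1 : ∑ _i : Fin (s.1 : ℕ), (-1 : ℤ) < ∑ i : Fin (s.1 : ℕ),
          if s.2 (outPos s.1 i) = s.2 (nextPos s.1 i) then (1 : ℤ) else -1 :=
        Finset.sum_lt_sum (fun i _ => by split_ifs <;> norm_num)
          ⟨i, Finset.mem_univ i, by rw [if_pos hi]; norm_num⟩
      simpa using h1
  · push Not at h
    simp [h]

/-- Variable by variable, `√(d(d-1))` times `((d-1)/d)^(±1/2)` is `d - 1` or `d`. The bound `2 ≤ d`
keeps the bases of the real powers positive. -/
theorem cloneWeight_of_two_le {d : ℕ} (hd : 2 ≤ d) (s : SignPattern) :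
    (cloneWeight d s : ℝ) = (d : ℝ) ^ (s.1 : ℕ) *
      (((d : ℝ) * ((d : ℝ) - 1)) ^ (((s.1 : ℕ) : ℝ) / 2) *
        (((d : ℝ) - 1) / (d : ℝ)) ^ ((1 / 2 : ℝ) * (s.corr : ℝ))) := by
  have hd2 : (2 : ℝ) ≤ d := by exact_mod_cast hd
  have h0 : (0 : ℝ) < d := by linarith
  have h1 : (0 : ℝ) < (d : ℝ) - 1 := by linarith
  have e1 : ((d : ℝ) * ((d : ℝ) - 1)) ^ (((s.1 : ℕ) : ℝ) / 2)
      = ∏ _i : Fin (s.1 : ℕ), ((d : ℝ) * ((d : ℝ) - 1)) ^ (1 / 2 : ℝ) := by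
    rw [Finset.prod_const, Finset.card_univ, Fintype.card_fin,
      ← Real.rpow_mul_natCast (by positivity)]
    congr 1
    ring
  have e2 : (((d : ℝ) - 1) / (d : ℝ)) ^ ((1 / 2 : ℝ) * (s.corr : ℝ))
      = ∏ i : Fin (s.1 : ℕ), (((d : ℝ) - 1) / (d : ℝ)) ^ ((1 / 2 : ℝ) *
        if s.2 (outPos s.1 i) = s.2 (nextPos s.1 i) then 1 else -1) := by
    rw [← Real.rpow_sum_of_pos (by positivity), ← Finset.mul_sum, corr_eq_sum_ite]
    push_cast
    rfl
  have e3 : (d : ℝ) ^ (s.1 : ℕ) = ∏ _i : Fin (s.1 : ℕ), (d : ℝ) := by simp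
  have hsq : ∀ x : ℝ, 0 ≤ x → x ^ (1 / 2 : ℝ) * x ^ (1 / 2 : ℝ) = x := fun x hx => by
    rw [← Real.sqrt_eq_rpow, Real.mul_self_sqrt hx]
  rw [e1, e2, e3, ← Finset.prod_mul_distrib, ← Finset.prod_mul_distrib, cloneWeight,
    Nat.cast_prod]
  refine Finset.prod_congr rfl fun i _ => ?_
  rw [Real.mul_rpow h0.le h1.le]
  have hs0 := Real.rpow_pos_of_pos h0 (1 / 2)
  have hs1 := Real.rpow_pos_of_pos h1 (1 / 2)
  have q0 := hsq d h0.le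
  have q1 := hsq (d - 1) h1.le
  split_ifs with h
  · rw [mul_one, Real.div_rpow h1.le h0.le, Nat.cast_mul, Nat.cast_sub (by omega), Nat.cast_one]
    have : (d : ℝ) ^ (1 / 2 : ℝ) * ((d : ℝ) - 1) ^ (1 / 2 : ℝ)
        * (((d : ℝ) - 1) ^ (1 / 2 : ℝ) / (d : ℝ) ^ (1 / 2 : ℝ)) = (d : ℝ) - 1 := by
      rw [mul_comm (_ ^ _), mul_assoc, mul_div_cancel₀ _ hs0.ne', q1]
    rw [this]
  · rw [mul_neg_one, Real.rpow_neg (by positivity), Real.div_rpow h1.le h0.le, Nat.cast_mul]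
    have : (d : ℝ) ^ (1 / 2 : ℝ) * ((d : ℝ) - 1) ^ (1 / 2 : ℝ)
        * (((d : ℝ) - 1) ^ (1 / 2 : ℝ) / (d : ℝ) ^ (1 / 2 : ℝ))⁻¹ = d := by
      rw [inv_div, mul_assoc, mul_div_cancel₀ _ hs1.ne', q0]
    rw [this]

/-- Per clause, `(2d/k) * k(k-1) / (2d)²` equals `((k-1)/2) / d`; the power of `d` is absorbed by
`cloneWeight`. -/
theorem cycleMean_eq {k d : ℕ} (hk : 1 ≤ k) (hd : 1 ≤ d) (s : SignPattern) :
    (2 * d / k : ℝ) ^ (s.1 : ℕ) * ((k : ℝ) * ((k - 1 : ℕ) : ℝ)) ^ (s.1 : ℕ)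
      / (2 * ((s.1 : ℕ) : ℝ)) * cloneWeight d s / ((2 * d : ℝ) ^ 2) ^ (s.1 : ℕ)
      = cycleMean k d s := by
  have hk0 : (k : ℝ) ≠ 0 := by exact_mod_cast (by omega : k ≠ 0)
  have hd0 : (d : ℝ) ≠ 0 := by exact_mod_cast (by omega : d ≠ 0)
  have key : (2 * d / k : ℝ) ^ (s.1 : ℕ) * ((k : ℝ) * ((k - 1 : ℕ) : ℝ)) ^ (s.1 : ℕ)
      / (2 * ((s.1 : ℕ) : ℝ)) * cloneWeight d s / ((2 * d : ℝ) ^ 2) ^ (s.1 : ℕ)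
      = 1 / (2 * ((s.1 : ℕ) : ℝ)) * (((k : ℝ) - 1) / 2) ^ (s.1 : ℕ)
        * (cloneWeight d s / (d : ℝ) ^ (s.1 : ℕ)) := by
    have : (2 * d / k : ℝ) ^ (s.1 : ℕ) * ((k : ℝ) * ((k - 1 : ℕ) : ℝ)) ^ (s.1 : ℕ)
        = (((k : ℝ) - 1) / 2) ^ (s.1 : ℕ) * ((2 * d : ℝ) ^ 2) ^ (s.1 : ℕ)
          / (d : ℝ) ^ (s.1 : ℕ) := by
      rw [← mul_pow, ← mul_pow, ← div_pow, Nat.cast_sub hk]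
      congr 1
      field_simp
      push_cast
      ring
    rw [this]
    have h2 : ((2 * d : ℝ) ^ 2) ^ (s.1 : ℕ) ≠ 0 := by positivity
    field_simp
  rw [key, cycleMean]
  congr 1
  by_cases h1 : d = 1
  · subst h1
    rw [if_pos rfl, cloneWeight_one]
    simp
  · rw [if_neg h1, cloneWeight_of_two_le (by omega), mul_div_cancel_left₀ _ (by positivity)]

open scoped Classical in
theorem randomFormula_real_eq_mean (k d n : ℕ) (A : Set (Formula (2 * d * n / k) k n d)) :
    (randomFormula k d n).real A = mean fun Φ => if Φ ∈ A then (1 : ℝ) else 0 := by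
  have : MeasurableSingletonClass (Formula (2 * d * n / k) k n d) := ⟨fun _ => trivial⟩
  rw [randomFormula, Measure.real, uniformOn_univ, mean, Finset.sum_boole,
    Measure.count_apply (MeasurableSpace.measurableSet_top)]
  simp [ENNReal.toReal_div, Set.encard_eq_coe_toFinset_card, Set.toFinset_card,
    Fintype.card_subtype]

end RegularKSAT

end

theorem mainTheorem5 (k d : ℕ) (hk : 1 ≤ k) (hd : 1 ≤ d)
    (S : Finset RegularKSAT.SignPattern) (c : RegularKSAT.SignPattern → ℕ) :
    Tendsto
      (fun n : ℕ => (RegularKSAT.randomFormula k d n).real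
        {Φ | ∀ s ∈ S, RegularKSAT.cycleCount s Φ = c s})
      (atTop ⊓ 𝓟 {n : ℕ | k ∣ 2 * d * n})
      (𝓝 (∏ s ∈ S, (poissonMeasure (RegularKSAT.cycleMean k d s).toNNReal).real {c s})) := by
  classical
  have hm : ∀ᶠ n in atTop ⊓ 𝓟 {n : ℕ | k ∣ 2 * d * n}, 2 * d * n / k * k = n * (d * 2) := by
    refine eventually_inf_principal.2 (Eventually.of_forall fun n hn => ?_)
    rw [Nat.div_mul_cancel hn]
    ring
  have h := RegularKSAT.tendsto_mean_indicator_of_factorial_moments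
    (F := atTop ⊓ 𝓟 {n : ℕ | k ∣ 2 * d * n})
    (Ω := fun n => RegularKSAT.Formula (2 * d * n / k) k n d)
    (fun n Φ (s : S) => RegularKSAT.cycleCount s.1 Φ)
    (fun s : S => RegularKSAT.cycleMean k d s.1) (fun r => by
      -- The family consists of `r s` labelled cycles of each pattern `s`, so the limiting product
      -- over labels collapses to powers of the means.
      have h1 := RegularKSAT.tendsto_mean_familyCount
        (fun τ : Σ s : S, Fin (r s) => (τ.1 : RegularKSAT.SignPattern)) inf_le_left
        (by omega) (by omega) hm
      simp only [RegularKSAT.cycleMean_eq hk hd, Fintype.prod_sigma, Finset.prod_const,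
        Finset.card_univ, Fintype.card_fin] at h1
      refine h1.congr fun n => ?_
      congr 1
      funext Φ
      rw [← RegularKSAT.prod_descFactorial_cycleCount]
      push_cast
      rfl) (fun s => c s.1)
  rw [← Finset.prod_coe_sort S fun s =>
    (poissonMeasure (RegularKSAT.cycleMean k d s).toNNReal).real {c s}]
  simp only [poissonMeasure_real_singleton,
    Real.coe_toNNReal _ (RegularKSAT.cycleMean_nonneg hk hd _)]
  refine h.congr fun n => ?_
  rw [RegularKSAT.randomFormula_real_eq_mean]
  congr 1
  funext Φ
  rw [Fintype.prod_boole]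
  simp
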